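/- Let $p\ge 2$, $n\ge p$, $\mu^*\in\mathbb R^p$, let $\Sigma\neq 0$ be a symmetric positive semidefinite $p\times p$ matrix, and write $\|\cdot\|$ for the Euclidean norm of vectors and the corresponding operator norm of matrices, $\lambda_{\max}$ for the largest eigenvalue, and $r_\Sigma=\operatorname{Tr}(\Sigma)/\|\Sigma\|$. **Model.** Let $\tau>0$ and $0<\varepsilon<\frac{5-\sqrt5}{10}$. Random vectors $X_1,\dots,X_n$ in $\mathbb R^p$ follow the sub-Gaussian model with adversarial contamination $\mathrm{SGAC}(\mu^*,\Sigma,\varepsilon)$ with variance proxy $\tau$ if there are independent (not necessarily identically distributed) random vectors $\xi_1,\dots,\xi_n$ in $\mathbb R^p$, each with mean zero, identity covariance matrix and $\mathbf E[e^{v^\top\xi_i}]\le e^{\frac{\tau}{2}\|v\|^2}$ for all $v\in\mathbb R^p$, such that, almost surely, $$\big|\{i : X_i\neq \mu^*+\Sigma^{1/2}\xi_i\}\big|\le \varepsilon n .$$ **Estimator.** Given $X_1,\dots,X_n$, let $\hat\mu^0\in\arg\min_{\mu\in\mathbb R^p}\sum_{i=1}^n\|X_i-\mu\|$ and, for $k=1,\dots,K$,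 let $$\hat w^k\in\arg\min_{w}\ \max\Big\{0,\ \lambda_{\max}\Big(\sum_{i=1}^n w_i(X_i-\hat\mu^{k-1})(X_i-\hat\mu^{k-1})^\top-\Sigma\Big)\Big\},\qquad \hat\mu^k=\sum_{i=1}^n\hat w^k_iX_i ,$$ where $w$ ranges over the probability vectors in $\mathbb R^n$ with $\max_i w_i\le \frac1{n-n\varepsilon}$, and $$K=\max\Big\{0,\ \Big\lceil\frac{\log(4r_\Sigma)-2\log(\varepsilon(1-2\varepsilon))}{2\log(1-2\varepsilon)-\log\varepsilon-\log(1-\varepsilon)}\Big\rceil\Big\}.$$ The iteratively reweighted mean is $\hat\mu_n^{\mathrm{IR}}=\hat\mu^K$, for an arbitrary choice of the minimizers. **Theorem.** For every $\tau>0$ there is a constant $A_5>0$ depending only on $\tau$ such that, for all $n\ge p\ge2$, all $0<\varepsilon<\frac{5-\sqrt5}{10}$, all $\delta\in(4e^{-n},1)$, all $\Sigma$ and $\mu^*$ as above and all $X_1,\dots,X_n$ following $\mathrm{SGAC}(\mu^*,\Sigma,\varepsilon)$ with variance proxy $\tau$, with probability at least $1-4\delta$, $$\big\|\hat\mu_n^{\mathrm{IR}}-\mu^*\big\|\le\frac{A_5\,\|\Sigma\|^{1/2}}{1-2\varepsilon-\sqrt{\varepsilon(1-\varepsilon)}}\left(\sqrt{\frac{p+\log(4/\delta)}{n}}+\varepsilon\sqrt{\log(1/\varepsilon)}\right).$$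 -/

import Mathlib

open MeasureTheory ProbabilityTheory
open scoped RealInnerProductSpace MatrixOrder

noncomputable section

namespace IRMean

/-- `ℝ^p` with its Euclidean norm. -/
abbrev Vec (p : ℕ) : Type := EuclideanSpace ℝ (Fin p)

/-- The operator norm of a matrix with respect to the Euclidean norm. -/
def opNorm {p : ℕ} (M : Matrix (Fin p) (Fin p) ℝ) : ℝ :=
  ‖Matrix.toEuclideanCLM (n := Fin p) (𝕜 := ℝ) M‖

/-- The largest eigenvalue of a symmetric matrix (of positive size). -/
def lambdaMax {p : ℕ} (M : Matrix (Fin p) (Fin p) ℝ) : ℝ :=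
  sSup (spectrum ℝ M)

/-- The positive part of the largest eigenvalue. -/
def lambdaMaxPos {p : ℕ} (M : Matrix (Fin p) (Fin p) ℝ) : ℝ :=
  max (lambdaMax M) 0

/-- The effective rank: trace divided by operator norm. -/
def effectiveRank {p : ℕ} (S : Matrix (Fin p) (Fin p) ℝ) : ℝ :=
  S.trace / opNorm S

/-! ### The iteratively reweighted mean -/

/-- The weighted mean of the points `x i` with weights `w i`. -/
def wmean {n p : ℕ} (x : Fin n → Vec p) (w : Fin n → ℝ) : Vec p :=
  ∑ i, w i • x i

/-- The weighted second moment matrix of the points `x i` around `m`. -/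
def scatter {n p : ℕ} (x : Fin n → Vec p) (w : Fin n → ℝ) (m : Vec p) :
    Matrix (Fin p) (Fin p) ℝ :=
  ∑ i, w i • Matrix.vecMulVec (x i - m).ofLp (x i - m).ofLp

/-- The cost function minimized over the weights at each iteration. -/
def cost {n p : ℕ} (S : Matrix (Fin p) (Fin p) ℝ) (x : Fin n → Vec p)
    (w : Fin n → ℝ) (m : Vec p) : ℝ :=
  lambdaMaxPos (scatter x w m - S)

/-- Admissible weights: probability vectors whose entries are at most `1 / (n - n ε)`. -/
def weights (n : ℕ) (ε : ℝ) : Set (Fin n → ℝ) :=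
  {w | w ∈ stdSimplex ℝ (Fin n) ∧ ∀ i, w i ≤ 1 / ((n : ℝ) - n * ε)}

/-- `m` is a geometric median of the points `x i`. -/
def IsGeomMedian {n p : ℕ} (x : Fin n → Vec p) (m : Vec p) : Prop :=
  ∀ m' : Vec p, ∑ i, ‖x i - m‖ ≤ ∑ i, ‖x i - m'‖

/-- The number of iterations; the ceiling with values in `ℕ` is the maximum of `0` and
the ceiling with values in `ℤ`. -/
def numIter {p : ℕ} (S : Matrix (Fin p) (Fin p) ℝ) (ε : ℝ) : ℕ :=
  ⌈(Real.log (4 * effectiveRank S) - 2 * Real.log (ε * (1 - 2 * ε))) /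
    (2 * Real.log (1 - 2 * ε) - Real.log ε - Real.log (1 - ε))⌉₊

/-- `m` is an output of the iteratively reweighted mean algorithm run on the data `x` with
covariance matrix `S` and contamination rate `ε`. The minimizers that the algorithm uses need
not be unique; every choice of them is an admissible run. -/
def IsIRMean {n p : ℕ} (S : Matrix (Fin p) (Fin p) ℝ) (ε : ℝ) (x : Fin n → Vec p)
    (m : Vec p) : Prop :=
  ∃ (mu : ℕ → Vec p) (w : ℕ → Fin n → ℝ),
    IsGeomMedian x (mu 0) ∧
    (∀ k < numIter S ε,
      w (k + 1) ∈ weights n ε ∧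
      (∀ w' ∈ weights n ε, cost S x (w (k + 1)) (mu k) ≤ cost S x w' (mu k)) ∧
      mu (k + 1) = wmean x (w (k + 1))) ∧
    m = mu (numIter S ε)

/-! ### The data-generating model -/

/-- `ξ` is a centered random vector with identity covariance matrix that is sub-Gaussian with
variance proxy `τ`. -/
structure IsSubGaussianVec {Ω : Type*} [MeasurableSpace Ω] {p : ℕ} (P : Measure Ω)
    (τ : ℝ) (ξ : Ω → Vec p) : Prop where
  measurable : Measurable ξ
  centered : ∫ ω, ξ ω ∂P = 0
  cov_eq : ∀ a b : Fin p,
    covariance (fun ω => ξ ω a) (fun ω => ξ ω b) P = (1 : Matrix (Fin p) (Fin p) ℝ) a b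
  integrable_exp : ∀ v : Vec p, Integrable (fun ω => Real.exp ⟪v, ξ ω⟫) P
  exp_le : ∀ v : Vec p, ∫ ω, Real.exp ⟪v, ξ ω⟫ ∂P ≤ Real.exp (τ / 2 * ‖v‖ ^ 2)

/-- The sub-Gaussian model with adversarial contamination: the random vectors `X i` coincide
with `μ + S^{1/2} ξ i`, the `ξ i` being independent (not necessarily identically distributed)
sub-Gaussian vectors, for all indices outside a set, random and arbitrarily dependent on the
`ξ i`, of cardinality at most `ε n`. -/
def SGAC {Ω : Type*} [MeasurableSpace Ω] {n p : ℕ} (P : Measure Ω) (τ : ℝ) (μ : Vec p)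
    (S : Matrix (Fin p) (Fin p) ℝ) (ε : ℝ) (X : Fin n → Ω → Vec p) : Prop :=
  (∀ i, Measurable (X i)) ∧
  ∃ ξ : Fin n → Ω → Vec p,
    (∀ i, IsSubGaussianVec P τ (ξ i)) ∧
    iIndepFun ξ P ∧
    ∀ᵐ ω ∂P,
      ({i : Fin n | X i ω ≠
        μ + Matrix.toEuclideanCLM (n := Fin p) (𝕜 := ℝ) (CFC.sqrt S) (ξ i ω)}.ncard : ℝ)
          ≤ ε * n

end IRMean

end

/-!
The error bound is a deterministic consequence of three properties of the standardized sample
`ξ i`, collected in `IRMean.IsRegularSample`: the sample mean and the sample covariance matrix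
deviate from their expectations by `O(√κ)`, where `κ = (p + log (4 / δ)) / n`, and weights of
small total mass carry a small part of the second moment in every direction. By
`IRMean.measure_not_isRegularSample_le` they hold with the required probability. In a fixed
direction all of them follow from Chernoff's bound, since the square of a sub-Gaussian variable
`g` has an exponential moment; the third one is a bound on `∑ (g i ^ 2 - T)₊` at the level
`T = 4 τ log (1 / ε)`, which makes a union bound over subsets of the sample unnecessary. A
`1 / 2`-net of the sphere with at most `5 ^ p` points then gives all directions at once.

On such a sample, any probability weights `u` with entries at most `1 / (n (1 - 2 ε))` have a
weighted mean of norm `O(r)`, where `r = √κ + ε √(log (1 / ε))`, and weighted second moments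
within `O(√κ + ε log (1 / ε))` of the identity (`IRMean.IsFlat.norm_sum_smul_le`,
`IRMean.IsFlat.abs_sum_mul_inner_sq_sub_le`). This applies to the uniform weights on the inliers,
which bound the minimal cost, and to the renormalized restriction to the inliers of the weights
that the algorithm selects. The distance `d` between the weighted mean and the weighted mean of
the inliers is bounded through the variance in the direction of `d`: the outliers have mass at most
`ε / (1 - ε)`, so a large distance forces a large variance, hence a large cost. This gives
`‖μ k - μ‖ ≤ α ‖μ (k - 1) - μ‖ + O(√‖Σ‖ r)` with `α = √(ε (1 - ε)) / (1 - 2 ε) < 1`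
(`IRMean.norm_wmean_sub_le`). The deviations of the second moments are larger than `r ^ 2`, but
enter with a factor `ε`, which brings them down to `r ^ 2` (`IRMean.remainder_le`). The
geometric median starts the iteration with an error `O(√(Tr Σ) / (1 - 2 ε))`, and the number of
iterations is just large enough to bring its contribution down to `O(ε √‖Σ‖)`.
-/

namespace IRMean

/-! ### Exponential moments of a sub-Gaussian variable and of its square -/

section Scalar

variable {Ω : Type*} [MeasurableSpace Ω] {P : Measure Ω} [IsProbabilityMeasure P]

theorem lintegral_exp_neg_mul_sq_add {τ : ℝ} (hτ : 0 < τ) (y : ℝ) :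
    ∫⁻ h : ℝ, ENNReal.ofReal (Real.exp (-τ * h ^ 2 + h * y)) =
      ENNReal.ofReal (Real.exp (y ^ 2 / (4 * τ))) * ENNReal.ofReal (√(Real.pi / τ)) := by
  have h1 : ∀ h : ℝ, ENNReal.ofReal (Real.exp (-τ * h ^ 2 + h * y)) =
      ENNReal.ofReal (Real.exp (y ^ 2 / (4 * τ))) *
        (fun h => ENNReal.ofReal (Real.exp (-τ * h ^ 2))) (h - y / (2 * τ)) := by
    intro h
    rw [← ENNReal.ofReal_mul (Real.exp_pos _).le, ← Real.exp_add]
    congr 2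
    field_simp
    ring
  simp_rw [h1]
  rw [lintegral_const_mul _ (by fun_prop), lintegral_sub_right_eq_self
    (fun h => ENNReal.ofReal (Real.exp (-τ * h ^ 2))),
    ← ofReal_integral_eq_lintegral_ofReal (integrable_exp_neg_mul_sq hτ)
      (Filter.Eventually.of_forall fun _ => (Real.exp_pos _).le), integral_gaussian]

/-- The square of a sub-Gaussian variable has an exponential moment. The bound follows by
averaging the bound on `E exp (h g)` over a Gaussian `h`. -/
theorem integral_exp_sq_le {τ : ℝ} (hτ : 0 < τ) {g : Ω → ℝ} (hg : Measurable g)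
    (hint : ∀ s : ℝ, Integrable (fun ω => Real.exp (s * g ω)) P)
    (hle : ∀ s : ℝ, ∫ ω, Real.exp (s * g ω) ∂P ≤ Real.exp (τ / 2 * s ^ 2)) :
    Integrable (fun ω => Real.exp (g ω ^ 2 / (4 * τ))) P ∧
      ∫ ω, Real.exp (g ω ^ 2 / (4 * τ)) ∂P ≤ 2 := by
  have key : (∫⁻ ω, ENNReal.ofReal (Real.exp (g ω ^ 2 / (4 * τ))) ∂P) *
      ENNReal.ofReal (√(Real.pi / τ)) ≤ ENNReal.ofReal (√(Real.pi / (τ / 2))) := by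
    rw [← lintegral_mul_const _ (by fun_prop)]
    simp_rw [← lintegral_exp_neg_mul_sq_add hτ]
    rw [lintegral_lintegral_swap (by fun_prop)]
    calc ∫⁻ h : ℝ, ∫⁻ ω, ENNReal.ofReal (Real.exp (-τ * h ^ 2 + h * g ω)) ∂P
        ≤ ∫⁻ h : ℝ, ENNReal.ofReal (Real.exp (-(τ / 2) * h ^ 2)) := by
          refine lintegral_mono fun h => ?_
          simp_rw [Real.exp_add, ENNReal.ofReal_mul (Real.exp_pos _).le]
          rw [lintegral_const_mul _ (by fun_prop), ← ofReal_integral_eq_lintegral_ofReal (hint h)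
            (Filter.Eventually.of_forall fun _ => (Real.exp_pos _).le),
            ← ENNReal.ofReal_mul (Real.exp_pos _).le]
          apply ENNReal.ofReal_le_ofReal
          calc _ ≤ Real.exp (-τ * h ^ 2) * Real.exp (τ / 2 * h ^ 2) := by
                gcongr; exact hle h
            _ = _ := by rw [← Real.exp_add]; congr 1; ring
      _ = _ := by
          rw [← ofReal_integral_eq_lintegral_ofReal (integrable_exp_neg_mul_sq (by positivity))
            (Filter.Eventually.of_forall fun _ => (Real.exp_pos _).le), integral_gaussian]
  have h2 : √(Real.pi / (τ / 2)) ≤ 2 * √(Real.pi / τ) := by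
    rw [Real.sqrt_le_left (by positivity), mul_pow, Real.sq_sqrt (by positivity)]
    have : 0 < Real.pi / τ := by positivity
    have h3 : Real.pi / (τ / 2) = 2 * (Real.pi / τ) := by field_simp
    linarith
  have h0 : 0 < √(Real.pi / τ) := by positivity
  have key2 : ∫⁻ ω, ENNReal.ofReal (Real.exp (g ω ^ 2 / (4 * τ))) ∂P ≤ ENNReal.ofReal 2 := by
    have h4 := key.trans (ENNReal.ofReal_le_ofReal h2)
    rw [ENNReal.ofReal_mul (by norm_num)] at h4
    exact (ENNReal.mul_le_mul_iff_left (by simpa using h0) ENNReal.ofReal_ne_top).1 h4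
  have hI : Integrable (fun ω => Real.exp (g ω ^ 2 / (4 * τ))) P := by
    refine ⟨by fun_prop, ?_⟩
    rw [hasFiniteIntegral_iff_ofReal (Filter.Eventually.of_forall fun _ => (Real.exp_pos _).le)]
    exact key2.trans_lt ENNReal.ofReal_lt_top
  refine ⟨hI, ?_⟩
  rw [← ofReal_integral_eq_lintegral_ofReal hI
    (Filter.Eventually.of_forall fun _ => (Real.exp_pos _).le)] at key2
  exact (ENNReal.ofReal_le_ofReal_iff (by norm_num)).1 key2

theorem exp_le_one_add_add_sq_mul_exp_abs (x : ℝ) :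
    Real.exp x ≤ 1 + x + x ^ 2 * Real.exp |x| := by
  have h := Complex.norm_exp_sub_sum_le_norm_mul_exp (x : ℂ) 2
  have e : Complex.exp (x : ℂ) - ∑ m ∈ Finset.range 2, (x : ℂ) ^ m / (m.factorial : ℂ) =
      ((Real.exp x - (1 + x) : ℝ) : ℂ) := by
    simp [Finset.sum_range_succ]
  rw [e, Complex.norm_real, Complex.norm_real, Real.norm_eq_abs, Real.norm_eq_abs, sq_abs] at h
  linarith [le_abs_self (Real.exp x - (1 + x))]

/-- Bernstein's condition for a squared variable with an exponential moment. -/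
theorem integral_exp_mul_sq_sub_one_le {τ : ℝ} (hτ : 0 < τ) {g : Ω → ℝ} (hg : Measurable g)
    (hI : Integrable (fun ω => Real.exp (g ω ^ 2 / (4 * τ))) P)
    (hle : ∫ ω, Real.exp (g ω ^ 2 / (4 * τ)) ∂P ≤ 2)
    (h2I : Integrable (fun ω => g ω ^ 2) P) (h2 : ∫ ω, g ω ^ 2 ∂P = 1)
    {l : ℝ} (hl : |l| ≤ 1 / (8 * τ)) :
    Integrable (fun ω => Real.exp (l * (g ω ^ 2 - 1))) P ∧
      ∫ ω, Real.exp (l * (g ω ^ 2 - 1)) ∂P ≤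
        Real.exp (256 * τ ^ 2 * Real.exp (1 / (4 * τ)) * l ^ 2) := by
  set D := 128 * τ ^ 2 * Real.exp (1 / (4 * τ)) with hD
  have hpt : ∀ ω, Real.exp (l * (g ω ^ 2 - 1)) ≤
      1 + l * (g ω ^ 2 - 1) + l ^ 2 * D * Real.exp (g ω ^ 2 / (4 * τ)) := by
    intro ω
    refine (exp_le_one_add_add_sq_mul_exp_abs _).trans ?_
    set y := g ω ^ 2 + 1 with hy
    have hy0 : 0 ≤ y := by positivity
    have h1 : |g ω ^ 2 - 1| ≤ y := by
      rw [abs_le]; constructor <;> nlinarith [sq_nonneg (g ω)]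
    have h3 : |l * (g ω ^ 2 - 1)| ≤ y / (8 * τ) := by
      rw [abs_mul]
      calc |l| * |g ω ^ 2 - 1| ≤ 1 / (8 * τ) * y := by gcongr
        _ = _ := by ring
    have h4 : (g ω ^ 2 - 1) ^ 2 ≤ y ^ 2 := by rw [← sq_abs]; gcongr
    have h5 : y ^ 2 ≤ 128 * τ ^ 2 * Real.exp (y / (8 * τ)) := by
      have := Real.quadratic_le_exp_of_nonneg (x := y / (8 * τ)) (by positivity)
      have h6 : (y / (8 * τ)) ^ 2 / 2 ≤ Real.exp (y / (8 * τ)) := by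
        have : 0 ≤ y / (8 * τ) := by positivity
        linarith
      calc y ^ 2 = 128 * τ ^ 2 * ((y / (8 * τ)) ^ 2 / 2) := by field_simp; ring
        _ ≤ _ := by gcongr
    have h7 : (l * (g ω ^ 2 - 1)) ^ 2 * Real.exp |l * (g ω ^ 2 - 1)| ≤
        l ^ 2 * (128 * τ ^ 2 * Real.exp (y / (8 * τ))) * Real.exp (y / (8 * τ)) := by
      rw [mul_pow]; gcongr; exact h4.trans h5
    have h8 : l ^ 2 * (128 * τ ^ 2 * Real.exp (y / (8 * τ))) * Real.exp (y / (8 * τ)) =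
        l ^ 2 * D * Real.exp (g ω ^ 2 / (4 * τ)) := by
      have : Real.exp (y / (8 * τ)) * Real.exp (y / (8 * τ)) =
          Real.exp (1 / (4 * τ)) * Real.exp (g ω ^ 2 / (4 * τ)) := by
        rw [← Real.exp_add, ← Real.exp_add]; congr 1; rw [hy]; field_simp; ring
      rw [hD]; linear_combination (l ^ 2 * (128 * τ ^ 2)) * this
    linarith
  have hL : Integrable (fun ω => l * (g ω ^ 2 - 1)) P :=
    (h2I.sub (integrable_const 1)).const_mul l
  have hR1 : Integrable (fun ω => 1 + l * (g ω ^ 2 - 1)) P := (integrable_const 1).add hL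
  have hR2 : Integrable (fun ω => l ^ 2 * D * Real.exp (g ω ^ 2 / (4 * τ))) P := hI.const_mul _
  have hR := hR1.add hR2
  have hint : Integrable (fun ω => Real.exp (l * (g ω ^ 2 - 1))) P := by
    refine hR.mono' (by fun_prop) (Filter.Eventually.of_forall fun ω => ?_)
    rw [Real.norm_eq_abs, abs_of_pos (Real.exp_pos _)]
    exact hpt ω
  refine ⟨hint, (integral_mono hint hR hpt).trans ?_⟩
  simp only [Pi.add_apply]
  rw [integral_add hR1 hR2, integral_add (integrable_const 1) hL, integral_const_mul,
    integral_const_mul, integral_sub h2I (integrable_const 1), h2]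
  simp only [integral_const, probReal_univ, smul_eq_mul, mul_one, sub_self, mul_zero,
    add_zero]
  have hD0 : 0 ≤ D := by positivity
  calc 1 + l ^ 2 * D * ∫ ω, Real.exp (g ω ^ 2 / (4 * τ)) ∂P ≤ 1 + l ^ 2 * D * 2 := by gcongr
    _ = 256 * τ ^ 2 * Real.exp (1 / (4 * τ)) * l ^ 2 + 1 := by rw [hD]; ring
    _ ≤ _ := Real.add_one_le_exp _

/-- The excess of `g ^ 2` over the level `4 τ log (1 / ε)` has an exponential moment that exceeds
one by `O(ε)` only. -/
theorem integral_exp_excess_le {τ ε : ℝ} (hτ : 0 < τ) (hε : 0 < ε) {g : Ω → ℝ}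
    (hg : Measurable g)
    (hI : Integrable (fun ω => Real.exp (g ω ^ 2 / (4 * τ))) P)
    (hle : ∫ ω, Real.exp (g ω ^ 2 / (4 * τ)) ∂P ≤ 2) :
    Integrable (fun ω => Real.exp (max (g ω ^ 2 - 4 * τ * Real.log (1 / ε)) 0 / (4 * τ))) P ∧
      ∫ ω, Real.exp (max (g ω ^ 2 - 4 * τ * Real.log (1 / ε)) 0 / (4 * τ)) ∂P ≤
        Real.exp (2 * ε) := by
  have hpt : ∀ ω, Real.exp (max (g ω ^ 2 - 4 * τ * Real.log (1 / ε)) 0 / (4 * τ)) ≤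
      1 + ε * Real.exp (g ω ^ 2 / (4 * τ)) := by
    intro ω
    rcases max_choice (g ω ^ 2 - 4 * τ * Real.log (1 / ε)) 0 with h | h <;> rw [h]
    · have : Real.exp ((g ω ^ 2 - 4 * τ * Real.log (1 / ε)) / (4 * τ)) =
          ε * Real.exp (g ω ^ 2 / (4 * τ)) := by
        rw [show (g ω ^ 2 - 4 * τ * Real.log (1 / ε)) / (4 * τ) =
          Real.log ε + g ω ^ 2 / (4 * τ) by
            rw [one_div, Real.log_inv]; field_simp; ring, Real.exp_add, Real.exp_log hε]
      rw [this]; linarith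
    · simp only [zero_div, Real.exp_zero]
      have := Real.exp_pos (g ω ^ 2 / (4 * τ))
      nlinarith
  have hR2 := hI.const_mul ε
  have hR := (integrable_const (μ := P) (1 : ℝ)).add hR2
  have hint : Integrable
      (fun ω => Real.exp (max (g ω ^ 2 - 4 * τ * Real.log (1 / ε)) 0 / (4 * τ))) P := by
    refine hR.mono' (by fun_prop) (Filter.Eventually.of_forall fun ω => ?_)
    rw [Real.norm_eq_abs, abs_of_pos (Real.exp_pos _)]
    exact hpt ω
  refine ⟨hint, (integral_mono hint hR hpt).trans ?_⟩
  simp only [Pi.add_apply]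
  rw [integral_add (integrable_const 1) hR2, integral_const_mul]
  calc _ ≤ (2 * ε) + 1 := by simp; nlinarith
    _ ≤ _ := Real.add_one_le_exp _

theorem measure_sum_ge_le_exp {n : ℕ} {Y : Fin n → Ω → ℝ} (hind : iIndepFun Y P)
    (hm : ∀ i, Measurable (Y i)) {b : ℝ}
    (hint : ∀ i, Integrable (fun ω => Real.exp (Y i ω)) P)
    (hle : ∀ i, ∫ ω, Real.exp (Y i ω) ∂P ≤ Real.exp b) (a : ℝ) :
    P {ω | a ≤ ∑ i, Y i ω} ≤ ENNReal.ofReal (Real.exp (n * b - a)) := by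
  have h1 := measure_ge_le_exp_mul_mgf (μ := P) (X := ∑ i, Y i) (t := 1) a zero_le_one
    (hind.integrable_exp_mul_sum hm (s := Finset.univ) (fun i _ => by simpa using hint i))
  rw [hind.mgf_sum hm Finset.univ] at h1
  have h2 : ∏ i, mgf (Y i) P 1 ≤ Real.exp (n * b) := by
    calc ∏ i, mgf (Y i) P 1 ≤ ∏ _i : Fin n, Real.exp b :=
          Finset.prod_le_prod (fun i _ => mgf_nonneg) fun i _ => by simpa [mgf] using hle i
      _ = _ := by simp [← Real.exp_nat_mul]
  rw [← ENNReal.ofReal_toReal (measure_ne_top P {ω | a ≤ ∑ i, Y i ω})]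
  apply ENNReal.ofReal_le_ofReal
  simp only [Finset.sum_apply] at h1
  refine h1.trans ?_
  rw [sub_eq_neg_add, Real.exp_add, neg_one_mul]
  gcongr

end Scalar

/-! ### Half-nets of the sphere -/

/-- `N` is a finite set of unit vectors that is `1 / 2`-dense in the unit sphere. -/
structure IsHalfNet {p : ℕ} (N : Finset (Vec p)) : Prop where
  norm_eq : ∀ v ∈ N, ‖v‖ = 1
  dense : ∀ x : Vec p, ‖x‖ = 1 → ∃ v ∈ N, ‖x - v‖ ≤ 1 / 2

theorem exists_isHalfNet (p : ℕ) : ∃ N : Finset (Vec p), IsHalfNet N ∧ N.card ≤ 5 ^ p := by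
  classical
  let good : Finset (Vec p) → Prop := fun s =>
    (∀ v ∈ s, ‖v‖ = 1) ∧ ∀ v ∈ s, ∀ w ∈ s, v ≠ w → 1 / 2 ≤ ‖v - w‖
  have hcard : ∀ s, good s → s.card ≤ 5 ^ p := by
    intro s hs
    have hinj : Function.Injective (fun v : Vec p => (2 : ℝ) • v) :=
      smul_right_injective _ two_ne_zero
    rw [← Finset.card_image_of_injective s hinj]
    have := Besicovitch.card_le_of_separated (s.image fun v : Vec p => (2 : ℝ) • v) ?_ ?_
    · simpa using this
    · intro c hc
      obtain ⟨v, hv, rfl⟩ := Finset.mem_image.1 hc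
      simp [norm_smul, hs.1 v hv]
    · intro c hc d hd hcd
      obtain ⟨v, hv, rfl⟩ := Finset.mem_image.1 hc
      obtain ⟨w, hw, rfl⟩ := Finset.mem_image.1 hd
      have := hs.2 v hv w hw (fun h => hcd (by rw [h]))
      rw [← smul_sub, norm_smul, Real.norm_ofNat]
      linarith
  let K : Set ℕ := {k | ∃ s, good s ∧ s.card = k}
  have hKb : BddAbove K := ⟨5 ^ p, by rintro k ⟨s, hs, rfl⟩; exact hcard s hs⟩
  have hKn : K.Nonempty := ⟨0, ∅, by simp [good]⟩
  obtain ⟨s, hs, hsc⟩ := Nat.sSup_mem hKn hKb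
  refine ⟨s, ⟨hs.1, fun x hx => ?_⟩, hcard s hs⟩
  by_contra! hfar
  have hxs : x ∉ s := fun h => by have := hfar x h; simp at this; linarith
  have hgood : good (insert x s) := by
    refine ⟨fun v hv => ?_, fun v hv w hw hvw => ?_⟩
    · rcases Finset.mem_insert.1 hv with rfl | hv
      exacts [hx, hs.1 v hv]
    · rcases Finset.mem_insert.1 hv with rfl | hvs <;>
        rcases Finset.mem_insert.1 hw with rfl | hws
      · exact absurd rfl hvw
      · exact (hfar w hws).le
      · rw [norm_sub_rev]; exact (hfar v hvs).le
      · exact hs.2 v hvs w hws hvw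
  have := le_csSup hKb ⟨_, hgood, rfl⟩
  rw [Finset.card_insert_of_notMem hxs, ← hsc] at this
  omega

variable {n p : ℕ}

theorem IsHalfNet.opNorm_le {N : Finset (Vec p)} (hN : IsHalfNet N) {F : Type*}
    [NormedAddCommGroup F] [NormedSpace ℝ F] (T : Vec p →L[ℝ] F) {b : ℝ} (hb : 0 ≤ b)
    (h : ∀ v ∈ N, ‖T v‖ ≤ b) : ‖T‖ ≤ 2 * b := by
  have h1 : ‖T‖ ≤ b + ‖T‖ / 2 := by
    refine T.opNorm_le_of_unit_norm (by positivity) fun x hx => ?_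
    obtain ⟨v, hv, hxv⟩ := hN.dense x hx
    calc ‖T x‖ = ‖T v + T (x - v)‖ := by rw [← map_add]; congr 2; abel
      _ ≤ ‖T v‖ + ‖T (x - v)‖ := norm_add_le _ _
      _ ≤ b + ‖T‖ * (1 / 2) := by
          gcongr
          exacts [h v hv, (T.le_opNorm _).trans (by gcongr)]
      _ = _ := by ring
  linarith

theorem IsHalfNet.sum_mul_inner_sq_le {N : Finset (Vec p)} (hN : IsHalfNet N)
    {r : Fin n → ℝ} (hr : ∀ i, 0 ≤ r i) (y : Fin n → Vec p) {b : ℝ} (hb : 0 ≤ b)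
    (h : ∀ v ∈ N, ∑ i, r i * ⟪v, y i⟫ ^ 2 ≤ b) (x : Vec p) :
    ∑ i, r i * ⟪x, y i⟫ ^ 2 ≤ 4 * b * ‖x‖ ^ 2 := by
  let T : Vec p →L[ℝ] EuclideanSpace ℝ (Fin n) := LinearMap.toContinuousLinearMap
    { toFun := fun x => WithLp.toLp 2 fun i => √(r i) * ⟪x, y i⟫
      map_add' := fun x z => by ext i; simp [inner_add_left, mul_add]
      map_smul' := fun c x => by ext i; simp [real_inner_smul_left]; ring }
  have hT : ∀ x, ‖T x‖ ^ 2 = ∑ i, r i * ⟪x, y i⟫ ^ 2 := by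
    intro x
    rw [EuclideanSpace.norm_sq_eq]
    refine Finset.sum_congr rfl fun i _ => ?_
    change ‖√(r i) * ⟪x, y i⟫‖ ^ 2 = _
    rw [Real.norm_eq_abs, sq_abs, mul_pow, Real.sq_sqrt (hr i)]
  have h1 := hN.opNorm_le T (Real.sqrt_nonneg b) fun v hv => by
    apply Real.le_sqrt_of_sq_le; rw [hT]; exact h v hv
  rw [← hT]
  calc ‖T x‖ ^ 2 ≤ (2 * √b * ‖x‖) ^ 2 := by
        gcongr; exact (T.le_opNorm x).trans (by gcongr)
    _ = _ := by rw [mul_pow, mul_pow, Real.sq_sqrt hb]; ring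

/-- An indefinite quadratic form is controlled by its values on a half-net. For unit vectors
`x` and `v` the vectors `x - v` and `x + v` are orthogonal, and `q x - q v` is the polar form of
`q` at this pair. The weights `2` and `1 / 2` given to the pair are what makes the argument work
at distance `1 / 2`. -/
theorem IsHalfNet.abs_sum_inner_sq_sub_le {N : Finset (Vec p)} (hN : IsHalfNet N)
    (y : Fin n → Vec p) (c : ℝ) {b : ℝ}
    (h : ∀ v ∈ N, |∑ i, ⟪v, y i⟫ ^ 2 - c| ≤ b) (x : Vec p) :
    |∑ i, ⟪x, y i⟫ ^ 2 - c * ‖x‖ ^ 2| ≤ 32 * b * ‖x‖ ^ 2 := by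
  let q : Vec p → ℝ := fun x => ∑ i, ⟪x, y i⟫ ^ 2 - c * ‖x‖ ^ 2
  have hqs : ∀ (t : ℝ) x, q (t • x) = t ^ 2 * q x := by
    intro t x
    simp only [q, real_inner_smul_left, norm_smul, mul_pow, Real.norm_eq_abs, sq_abs, mul_sub,
      Finset.mul_sum]
    ring
  rcases eq_or_ne x 0 with rfl | hx0
  · simp
  have hq : Continuous q := by fun_prop
  have hsph : (Metric.sphere (0 : Vec p) 1).Nonempty := ⟨‖x‖⁻¹ • x, by simp [norm_smul, hx0]⟩
  obtain ⟨x₀, hx₀, hmax⟩ := (isCompact_sphere (0 : Vec p) 1).exists_isMaxOn hsph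
    (hq.abs.continuousOn)
  set s := |q x₀| with hs
  have hs0 : 0 ≤ s := abs_nonneg _
  have hall : ∀ z, |q z| ≤ s * ‖z‖ ^ 2 := by
    intro z
    rcases eq_or_ne z 0 with rfl | hz0
    · simp [q]
    have h1 : |q (‖z‖⁻¹ • z)| ≤ s := hmax (by simp [norm_smul, hz0])
    rw [hqs, abs_mul, abs_of_nonneg (by positivity)] at h1
    have hz : 0 < ‖z‖ := norm_pos_iff.2 hz0
    calc |q z| = ‖z‖⁻¹ ^ 2 * |q z| * ‖z‖ ^ 2 := by field_simp
      _ ≤ _ := by gcongr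
  have hx₀' : ‖x₀‖ = 1 := by simpa using hx₀
  obtain ⟨v, hv, hxv⟩ := hN.dense x₀ hx₀'
  have hv1 := hN.norm_eq v hv
  have e1 : ‖(2 : ℝ) • (x₀ - v) + (1 / 2 : ℝ) • (x₀ + v)‖ ^ 2 =
      4 * ‖x₀ - v‖ ^ 2 + (4 - ‖x₀ - v‖ ^ 2) / 4 := by
    simp only [norm_add_sq_real, norm_sub_sq_real, norm_smul, real_inner_smul_left,
      real_inner_smul_right, inner_sub_left, inner_add_right, real_inner_self_eq_norm_sq,
      real_inner_comm x₀ v, hx₀', hv1, mul_pow, Real.norm_eq_abs, sq_abs]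
    ring
  have e2 : ‖(2 : ℝ) • (x₀ - v) - (1 / 2 : ℝ) • (x₀ + v)‖ ^ 2 =
      4 * ‖x₀ - v‖ ^ 2 + (4 - ‖x₀ - v‖ ^ 2) / 4 := by
    simp only [norm_add_sq_real, norm_sub_sq_real, norm_smul, real_inner_smul_left,
      real_inner_smul_right, inner_sub_left, inner_add_right, real_inner_self_eq_norm_sq,
      real_inner_comm x₀ v, hx₀', hv1, mul_pow, Real.norm_eq_abs, sq_abs]
    ring
  have e3 : q x₀ - q v = (q ((2 : ℝ) • (x₀ - v) + (1 / 2 : ℝ) • (x₀ + v)) -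
      q ((2 : ℝ) • (x₀ - v) - (1 / 2 : ℝ) • (x₀ + v))) / 4 := by
    simp only [q, e1, e2, hx₀', hv1]
    have : ∀ i, ⟪x₀, y i⟫ ^ 2 - ⟪v, y i⟫ ^ 2 =
        (⟪(2 : ℝ) • (x₀ - v) + (1 / 2 : ℝ) • (x₀ + v), y i⟫ ^ 2 -
          ⟪(2 : ℝ) • (x₀ - v) - (1 / 2 : ℝ) • (x₀ + v), y i⟫ ^ 2) / 4 := by
      intro i
      simp only [inner_add_left, inner_sub_left, real_inner_smul_left]
      ring
    have h2 := Finset.sum_congr (rfl : Finset.univ = (Finset.univ : Finset (Fin n)))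
      fun i _ => this i
    rw [Finset.sum_sub_distrib, ← Finset.sum_div, Finset.sum_sub_distrib] at h2
    linarith
  have hsq : ‖x₀ - v‖ ^ 2 ≤ 1 / 4 := by nlinarith [norm_nonneg (x₀ - v)]
  have hb : |q v| ≤ b := by have := h v hv; simpa [q, hv1] using this
  have f1 := hall ((2 : ℝ) • (x₀ - v) + (1 / 2 : ℝ) • (x₀ + v))
  have f2 := hall ((2 : ℝ) • (x₀ - v) - (1 / 2 : ℝ) • (x₀ + v))
  rw [e1] at f1; rw [e2] at f2
  have f3 : s ≤ |q v| + (|q ((2 : ℝ) • (x₀ - v) + (1 / 2 : ℝ) • (x₀ + v))| +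
      |q ((2 : ℝ) • (x₀ - v) - (1 / 2 : ℝ) • (x₀ + v))|) / 4 := by
    have g1 : q x₀ = q v + (q ((2 : ℝ) • (x₀ - v) + (1 / 2 : ℝ) • (x₀ + v)) -
      q ((2 : ℝ) • (x₀ - v) - (1 / 2 : ℝ) • (x₀ + v))) / 4 := by linarith
    rw [hs, g1]
    refine (abs_add_le _ _).trans ?_
    rw [abs_div, abs_of_pos (by norm_num : (0 : ℝ) < 4)]
    gcongr
    exact abs_sub _ _
  have f4 : s * (4 * ‖x₀ - v‖ ^ 2 + (4 - ‖x₀ - v‖ ^ 2) / 4) ≤ s * (31 / 16) := by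
    gcongr; linarith
  have hsb : s ≤ 32 * b := by linarith
  exact (hall x).trans (by gcongr)

/-! ### Marginals of sub-Gaussian vectors -/

section Marginal

variable {Ω : Type*} [MeasurableSpace Ω] {P : Measure Ω} {p : ℕ} {τ : ℝ} {ξ : Ω → Vec p}

namespace IsSubGaussianVec

theorem measurable_inner (h : IsSubGaussianVec P τ ξ) (v : Vec p) :
    Measurable fun ω => ⟪v, ξ ω⟫ := by
  have := h.measurable
  fun_prop

theorem integrable_exp_mul_inner (h : IsSubGaussianVec P τ ξ) (v : Vec p) (s : ℝ) :
    Integrable (fun ω => Real.exp (s * ⟪v, ξ ω⟫)) P := by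
  simpa [real_inner_smul_left] using h.integrable_exp (s • v)

theorem integral_exp_mul_inner_le (h : IsSubGaussianVec P τ ξ) {v : Vec p} (hv : ‖v‖ = 1)
    (s : ℝ) : ∫ ω, Real.exp (s * ⟪v, ξ ω⟫) ∂P ≤ Real.exp (τ / 2 * s ^ 2) := by
  simpa [real_inner_smul_left, norm_smul, hv] using h.exp_le (s • v)

theorem memLp_inner (h : IsSubGaussianVec P τ ξ) (v : Vec p) :
    MemLp (fun ω => ⟪v, ξ ω⟫) 2 P := by
  refine memLp_of_mem_interior_integrableExpSet ?_ 2
  have : integrableExpSet (fun ω => ⟪v, ξ ω⟫) P = Set.univ :=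
    Set.eq_univ_of_forall fun s => h.integrable_exp_mul_inner v s
  simp [this]

theorem memLp_coord (h : IsSubGaussianVec P τ ξ) (a : Fin p) : MemLp (fun ω => ξ ω a) 2 P := by
  simpa [EuclideanSpace.inner_single_left] using h.memLp_inner (EuclideanSpace.single a (1 : ℝ))

variable [IsProbabilityMeasure P]

theorem integral_inner_eq_zero (h : IsSubGaussianVec P τ ξ) (v : Vec p) :
    ∫ ω, ⟪v, ξ ω⟫ ∂P = 0 := by
  have hξ : Integrable ξ P :=
    (MemLp.of_eval_piLp (q := 2) (p := 2) (f := ξ) h.memLp_coord).integrable (by norm_num)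
  rw [integral_inner hξ, h.centered, inner_zero_right]

theorem integral_inner_sq (h : IsSubGaussianVec P τ ξ) {v : Vec p} (hv : ‖v‖ = 1) :
    ∫ ω, ⟪v, ξ ω⟫ ^ 2 ∂P = 1 := by
  have h1 : covariance (fun ω => ⟪v, ξ ω⟫) (fun ω => ⟪v, ξ ω⟫) P = 1 := by
    have e : (fun ω => ⟪v, ξ ω⟫) = fun ω => ∑ a, v a * ξ ω a := by
      funext ω; simp [PiLp.inner_apply, mul_comm]
    rw [e, covariance_fun_sum_fun_sum (fun a => (h.memLp_coord a).const_mul _)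
      (fun a => (h.memLp_coord a).const_mul _)]
    simp_rw [covariance_const_mul_left, covariance_const_mul_right, h.cov_eq]
    have := EuclideanSpace.norm_sq_eq v
    simp [Matrix.one_apply]
    simp [hv] at this
    simp [this, ← sq]
  rw [covariance, h.integral_inner_eq_zero] at h1
  simpa [← sq] using h1

end IsSubGaussianVec

variable [IsProbabilityMeasure P] {n : ℕ} {Ξ : Fin n → Ω → Vec p}

theorem measure_sum_inner_ge_le (h : ∀ i, IsSubGaussianVec P τ (Ξ i)) (hind : iIndepFun Ξ P)
    {v : Vec p} (hv : ‖v‖ = 1) {κ : ℝ} (hκ : 0 ≤ κ) :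
    P {ω | (τ / 2 + 2) * n * √κ ≤ ∑ i, ⟪v, Ξ i ω⟫} ≤ ENNReal.ofReal (Real.exp (-(2 * n * κ))) := by
  have hY := hind.comp (fun _ x => √κ * ⟪v, x⟫) (fun _ => by fun_prop)
  have := measure_sum_ge_le_exp hY (fun i => ((h i).measurable_inner v).const_mul _)
    (fun i => (h i).integrable_exp_mul_inner v √κ)
    (fun i => (h i).integral_exp_mul_inner_le hv √κ) (n * κ * (τ / 2 + 2))
  refine (measure_mono fun ω hω => ?_).trans (this.trans (le_of_eq ?_))
  · simp only [Set.mem_ofPred_eq, Function.comp_apply, ← Finset.mul_sum] at hω ⊢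
    calc n * κ * (τ / 2 + 2) = √κ * ((τ / 2 + 2) * n * √κ) := by
          linear_combination (-(n : ℝ) * (τ / 2 + 2)) * Real.mul_self_sqrt hκ
      _ ≤ _ := by gcongr
  · rw [Real.sq_sqrt hκ]; congr 2; ring

/-- Two-sided deviations of an empirical second moment, the sign being `u = 1` or `u = -1`. -/
theorem measure_sum_inner_sq_sub_ge_le (hτ : 0 < τ) (h : ∀ i, IsSubGaussianVec P τ (Ξ i))
    (hind : iIndepFun Ξ P) {v : Vec p} (hv : ‖v‖ = 1) {κ : ℝ} (hκ : 0 ≤ κ) (hκ2 : κ ≤ 2)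
    {u : ℝ} (hu : |u| = 1) :
    P {ω | 16 * τ * (Real.exp (1 / (4 * τ)) + 2) * n * √κ ≤ u * (∑ i, ⟪v, Ξ i ω⟫ ^ 2 - n)} ≤
      ENNReal.ofReal (Real.exp (-(2 * n * κ))) := by
  have hκ' : √κ ≤ 2 := by rw [Real.sqrt_le_left (by norm_num)]; linarith
  have hu2 : u ^ 2 = 1 := by rw [← sq_abs, hu]; norm_num
  set l := u * √κ / (16 * τ) with hl
  have hl' : |l| ≤ 1 / (8 * τ) := by
    rw [hl, abs_div, abs_mul, hu, abs_of_nonneg (Real.sqrt_nonneg κ),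
      abs_of_pos (by positivity : 0 < 16 * τ), div_le_div_iff₀ (by positivity) (by positivity)]
    nlinarith
  have hsq : 256 * τ ^ 2 * Real.exp (1 / (4 * τ)) * l ^ 2 = Real.exp (1 / (4 * τ)) * κ := by
    rw [hl, div_pow, mul_pow, hu2, Real.sq_sqrt hκ]; field_simp; ring
  have hexp := fun i => integral_exp_sq_le hτ ((h i).measurable_inner v)
    ((h i).integrable_exp_mul_inner v) ((h i).integral_exp_mul_inner_le hv)
  have hB := fun i => integral_exp_mul_sq_sub_one_le hτ ((h i).measurable_inner v) (hexp i).1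
    (hexp i).2 ((h i).memLp_inner v).integrable_sq ((h i).integral_inner_sq hv) hl'
  have hY := hind.comp (fun _ x => l * (⟪v, x⟫ ^ 2 - 1)) (fun _ => by fun_prop)
  have := measure_sum_ge_le_exp hY
    (fun i => ((((h i).measurable_inner v).pow_const 2).sub_const 1).const_mul l)
    (fun i => (hB i).1) (fun i => (hB i).2) (n * κ * (Real.exp (1 / (4 * τ)) + 2))
  refine (measure_mono fun ω hω => ?_).trans (this.trans (le_of_eq ?_))
  · simp only [Set.mem_ofPred_eq, Function.comp_apply, ← Finset.mul_sum,
      Finset.sum_sub_distrib] at hω ⊢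
    simp only [Finset.sum_const, Finset.card_univ, Fintype.card_fin, nsmul_eq_mul, mul_one]
    calc n * κ * (Real.exp (1 / (4 * τ)) + 2)
        = √κ / (16 * τ) * (16 * τ * (Real.exp (1 / (4 * τ)) + 2) * n * √κ) := by
          field_simp; rw [Real.sq_sqrt hκ]
      _ ≤ √κ / (16 * τ) * (u * (∑ i, ⟪v, Ξ i ω⟫ ^ 2 - n)) := by gcongr
      _ = _ := by rw [hl]; ring
  · rw [hsq]; congr 2; ring

theorem measure_sum_excess_ge_le {ε : ℝ} (hτ : 0 < τ) (hε : 0 < ε)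
    (h : ∀ i, IsSubGaussianVec P τ (Ξ i))
    (hind : iIndepFun Ξ P) {v : Vec p} (hv : ‖v‖ = 1) {κ : ℝ} :
    P {ω | 8 * τ * n * (ε + κ) ≤
        ∑ i, max (⟪v, Ξ i ω⟫ ^ 2 - 4 * τ * Real.log (1 / ε)) 0} ≤
      ENNReal.ofReal (Real.exp (-(2 * n * κ))) := by
  have hexp := fun i => integral_exp_sq_le hτ ((h i).measurable_inner v)
    ((h i).integrable_exp_mul_inner v) ((h i).integral_exp_mul_inner_le hv)
  have hB := fun i => integral_exp_excess_le hτ hε ((h i).measurable_inner v) (hexp i).1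
    (hexp i).2
  have hf : Measurable fun x : Vec p =>
      max (⟪v, x⟫ ^ 2 - 4 * τ * Real.log (1 / ε)) 0 / (4 * τ) := by fun_prop
  have hY := hind.comp (fun _ x => max (⟪v, x⟫ ^ 2 - 4 * τ * Real.log (1 / ε)) 0 / (4 * τ))
    (fun _ => hf)
  have := measure_sum_ge_le_exp hY (fun i => hf.comp (h i).measurable)
    (fun i => (hB i).1) (fun i => (hB i).2) (2 * n * (ε + κ))
  refine (measure_mono fun ω hω => ?_).trans (this.trans (le_of_eq ?_))
  · simp only [Set.mem_ofPred_eq, Function.comp_apply, ← Finset.sum_div] at hω ⊢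
    rw [le_div_iff₀ (by positivity)]
    linarith
  · congr 2; ring

end Marginal

/-! ### Regular samples -/

/-- The deterministic properties of a sample of standardized vectors on which the error bound
rests: the sample mean and the sample covariance matrix are close to their expectations, and no
set of weights of small total mass carries much of the second moment in any direction. -/
structure IsRegularSample {n p : ℕ} (C ε κ : ℝ) (ξ : Fin n → Vec p) : Prop where
  norm_sum_le : ‖∑ i, ξ i‖ ≤ C * n * √κ
  abs_sum_inner_sq_sub_le : ∀ x, |∑ i, ⟪x, ξ i⟫ ^ 2 - n * ‖x‖ ^ 2| ≤ C * n * √κ * ‖x‖ ^ 2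
  sum_mul_inner_sq_le : ∀ (r : Fin n → ℝ) (b : ℝ), (∀ i, 0 ≤ r i ∧ r i ≤ b / n) → ∀ x,
    ∑ i, r i * ⟪x, ξ i⟫ ^ 2 ≤ C * (Real.log (1 / ε) * ∑ i, r i + b * (ε + κ)) * ‖x‖ ^ 2

/-- The constant for which samples of sub-Gaussian vectors are regular. -/
noncomputable def regConst (τ : ℝ) : ℝ := τ + 4 + 512 * τ * (Real.exp (1 / (4 * τ)) + 2)

/-- On a half-net, finitely many scalar inequalities imply regularity. -/
theorem IsHalfNet.isRegularSample {n p : ℕ} {N : Finset (Vec p)} (hN : IsHalfNet N) (hn : 0 < n)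
    {τ ε κ : ℝ} (hτ : 0 < τ) (hε : 0 < ε) (hε1 : ε ≤ 1) (hκ : 0 ≤ κ) {ξ : Fin n → Vec p}
    (h1 : ∀ v ∈ N, |∑ i, ⟪v, ξ i⟫| ≤ (τ / 2 + 2) * n * √κ)
    (h2 : ∀ v ∈ N, |∑ i, ⟪v, ξ i⟫ ^ 2 - n| ≤
      16 * τ * (Real.exp (1 / (4 * τ)) + 2) * n * √κ)
    (h3 : ∀ v ∈ N, ∑ i, max (⟪v, ξ i⟫ ^ 2 - 4 * τ * Real.log (1 / ε)) 0 ≤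
      8 * τ * n * (ε + κ)) :
    IsRegularSample (regConst τ) ε κ ξ := by
  have hn' : (0 : ℝ) < n := by exact_mod_cast hn
  have hexp := Real.exp_pos (1 / (4 * τ))
  have hlog : 0 ≤ Real.log (1 / ε) := Real.log_nonneg (by rw [le_div_iff₀ hε]; linarith)
  refine ⟨?_, fun x => ?_, fun r b hr x => ?_⟩
  · have := hN.opNorm_le (innerSL ℝ (∑ i, ξ i)) (b := (τ / 2 + 2) * n * √κ) (by positivity)
      fun v hv => by
        simpa [real_inner_comm v, inner_sum] using h1 v hv
    rw [innerSL_apply_norm] at this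
    refine this.trans ?_
    have hc : 2 * (τ / 2 + 2) ≤ regConst τ := by
      rw [regConst]; have : 0 < 512 * τ * (Real.exp (1 / (4 * τ)) + 2) := by positivity
      linarith
    calc _ = 2 * (τ / 2 + 2) * n * √κ := by ring
      _ ≤ _ := by gcongr
  · refine (hN.abs_sum_inner_sq_sub_le ξ n h2 x).trans ?_
    have hc : 512 * τ * (Real.exp (1 / (4 * τ)) + 2) ≤ regConst τ := by
      rw [regConst]; linarith
    calc _ = 512 * τ * (Real.exp (1 / (4 * τ)) + 2) * n * √κ * ‖x‖ ^ 2 := by ring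
      _ ≤ _ := by gcongr
  · have hb : 0 ≤ b := by
      have := (hr ⟨0, hn⟩).1.trans (hr ⟨0, hn⟩).2
      by_contra! hneg
      exact absurd this (not_le.2 (div_neg_of_neg_of_pos hneg hn'))
    have hR : 0 ≤ ∑ i, r i := Finset.sum_nonneg fun i _ => (hr i).1
    have hc : 32 * τ ≤ regConst τ := by
      rw [regConst]; nlinarith [mul_pos hτ hexp]
    have := hN.sum_mul_inner_sq_le (fun i => (hr i).1) ξ
      (b := 4 * τ * Real.log (1 / ε) * ∑ i, r i + 8 * τ * (b * (ε + κ))) (by positivity)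
      (fun v hv => ?_) x
    · refine this.trans (mul_le_mul_of_nonneg_right ?_ (sq_nonneg _))
      calc 4 * (4 * τ * Real.log (1 / ε) * ∑ i, r i + 8 * τ * (b * (ε + κ)))
          ≤ 32 * τ * (Real.log (1 / ε) * ∑ i, r i + b * (ε + κ)) := by
            have : 0 ≤ τ * (Real.log (1 / ε) * ∑ i, r i) := by positivity
            linarith
        _ ≤ _ := by gcongr
    · calc ∑ i, r i * ⟪v, ξ i⟫ ^ 2
          ≤ ∑ i, (4 * τ * Real.log (1 / ε) * r i +
              b / n * max (⟪v, ξ i⟫ ^ 2 - 4 * τ * Real.log (1 / ε)) 0) := by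
            refine Finset.sum_le_sum fun i _ => ?_
            have e1 := mul_le_mul_of_nonneg_left
              (le_max_left (⟪v, ξ i⟫ ^ 2 - 4 * τ * Real.log (1 / ε)) 0) (hr i).1
            have e2 := mul_le_mul_of_nonneg_right (hr i).2
              (le_max_right (⟪v, ξ i⟫ ^ 2 - 4 * τ * Real.log (1 / ε)) 0)
            linarith
        _ = 4 * τ * Real.log (1 / ε) * ∑ i, r i +
              b / n * ∑ i, max (⟪v, ξ i⟫ ^ 2 - 4 * τ * Real.log (1 / ε)) 0 := by
            rw [Finset.sum_add_distrib, Finset.mul_sum, Finset.mul_sum]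
        _ ≤ 4 * τ * Real.log (1 / ε) * ∑ i, r i + b / n * (8 * τ * n * (ε + κ)) := by
            gcongr; exact h3 v hv
        _ = _ := by field_simp

theorem measure_not_isRegularSample_le {Ω : Type*} [MeasurableSpace Ω] {P : Measure Ω}
    [IsProbabilityMeasure P] {n p : ℕ} (hn : 0 < n) {τ ε κ : ℝ} (hτ : 0 < τ) (hε : 0 < ε)
    (hε1 : ε ≤ 1) (hκ : 0 ≤ κ) (hκ2 : κ ≤ 2) {Ξ : Fin n → Ω → Vec p}
    (h : ∀ i, IsSubGaussianVec P τ (Ξ i)) (hind : iIndepFun Ξ P) :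
    P {ω | ¬ IsRegularSample (regConst τ) ε κ fun i => Ξ i ω} ≤
      ENNReal.ofReal (5 ^ p * (5 * Real.exp (-(2 * n * κ)))) := by
  obtain ⟨N, hN, hcard⟩ := exists_isHalfNet p
  let bad : Vec p → Set Ω := fun v =>
    {ω | (τ / 2 + 2) * n * √κ ≤ ∑ i, ⟪v, Ξ i ω⟫} ∪
    {ω | (τ / 2 + 2) * n * √κ ≤ ∑ i, ⟪-v, Ξ i ω⟫} ∪
    {ω | 16 * τ * (Real.exp (1 / (4 * τ)) + 2) * n * √κ ≤ 1 * (∑ i, ⟪v, Ξ i ω⟫ ^ 2 - n)} ∪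
    {ω | 16 * τ * (Real.exp (1 / (4 * τ)) + 2) * n * √κ ≤ -1 * (∑ i, ⟪v, Ξ i ω⟫ ^ 2 - n)} ∪
    {ω | 8 * τ * n * (ε + κ) ≤ ∑ i, max (⟪v, Ξ i ω⟫ ^ 2 - 4 * τ * Real.log (1 / ε)) 0}
  have hbad : ∀ v ∈ N, P (bad v) ≤ ENNReal.ofReal (5 * Real.exp (-(2 * n * κ))) := by
    intro v hv
    have hv1 := hN.norm_eq v hv
    have hE := (Real.exp_pos (-(2 * n * κ))).le
    have b1 := measure_sum_inner_ge_le h hind hv1 hκ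
    have b2 := measure_sum_inner_ge_le h hind (v := -v) (by simpa using hv1) hκ
    have b3 := measure_sum_inner_sq_sub_ge_le hτ h hind hv1 hκ hκ2 (u := 1) (by simp)
    have b4 := measure_sum_inner_sq_sub_ge_le hτ h hind hv1 hκ hκ2 (u := -1) (by simp)
    have b5 := measure_sum_excess_ge_le hτ hε h hind hv1 (κ := κ)
    rw [show 5 * Real.exp (-(2 * n * κ)) = Real.exp (-(2 * n * κ)) + Real.exp (-(2 * n * κ)) +
      Real.exp (-(2 * n * κ)) + Real.exp (-(2 * n * κ)) + Real.exp (-(2 * n * κ)) by ring]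
    rw [ENNReal.ofReal_add (by positivity) hE, ENNReal.ofReal_add (by positivity) hE,
      ENNReal.ofReal_add (by positivity) hE, ENNReal.ofReal_add hE hE]
    refine (measure_union_le _ _).trans (add_le_add ?_ b5)
    refine (measure_union_le _ _).trans (add_le_add ?_ b4)
    refine (measure_union_le _ _).trans (add_le_add ?_ b3)
    exact (measure_union_le _ _).trans (add_le_add b1 b2)
  have hsub : {ω | ¬ IsRegularSample (regConst τ) ε κ fun i => Ξ i ω} ⊆ ⋃ v ∈ N, bad v := by
    intro ω hω
    by_contra hgood
    refine hω (hN.isRegularSample hn hτ hε hε1 hκ ?_ ?_ ?_) <;> intro v hv <;>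
    · have hv' : ω ∉ bad v := fun hb => hgood (Set.mem_biUnion hv hb)
      simp only [bad, Set.mem_union, Set.mem_ofPred_eq, not_or, not_le, inner_neg_left,
        Finset.sum_neg_distrib] at hv'
      obtain ⟨⟨⟨⟨c1, c2⟩, c3⟩, c4⟩, c5⟩ := hv'
      first
        | exact c5.le
        | exact abs_le.2 ⟨by linarith, by linarith⟩
  calc P {ω | ¬ IsRegularSample (regConst τ) ε κ fun i => Ξ i ω}
      ≤ P (⋃ v ∈ N, bad v) := measure_mono hsub
    _ ≤ ∑ v ∈ N, P (bad v) := measure_biUnion_finset_le _ _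
    _ ≤ ∑ _v ∈ N, ENNReal.ofReal (5 * Real.exp (-(2 * n * κ))) := Finset.sum_le_sum hbad
    _ = (N.card : ENNReal) * ENNReal.ofReal (5 * Real.exp (-(2 * n * κ))) := by simp
    _ ≤ ENNReal.ofReal (5 ^ p) * ENNReal.ofReal (5 * Real.exp (-(2 * n * κ))) := by
        gcongr
        rw [← ENNReal.ofReal_natCast]
        exact ENNReal.ofReal_le_ofReal (by exact_mod_cast hcard)
    _ = _ := (ENNReal.ofReal_mul (by positivity)).symm

/-! ### Quadratic forms, the largest eigenvalue and the square root -/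

section Matrices

variable {n p : ℕ}

/-- The linear map of a matrix on Euclidean space. -/
noncomputable abbrev toCLM (M : Matrix (Fin p) (Fin p) ℝ) : Vec p →L[ℝ] Vec p :=
  Matrix.toEuclideanCLM (n := Fin p) (𝕜 := ℝ) M

theorem inner_toCLM_le_lambdaMaxPos {M : Matrix (Fin p) (Fin p) ℝ} (hM : M.IsHermitian)
    (x : Vec p) : ⟪x, toCLM M x⟫ ≤ lambdaMaxPos M * ‖x‖ ^ 2 := by
  have hle : M ≤ algebraMap ℝ (Matrix (Fin p) (Fin p) ℝ) (lambdaMax M) := by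
    refine le_algebraMap_of_spectrum_le (fun y hy => ?_) hM.isSelfAdjoint
    exact le_csSup M.finite_real_spectrum.bddAbove hy
  have h1 := (Matrix.le_iff.1 hle).dotProduct_mulVec_nonneg x.ofLp
  have h2 : (0 : ℝ) ≤ lambdaMax M * ‖x‖ ^ 2 - ⟪x, toCLM M x⟫ := by
    have e : dotProduct x.ofLp x.ofLp = ‖x‖ ^ 2 := by
      rw [EuclideanSpace.real_norm_sq_eq]; simp [dotProduct, sq]
    rw [Matrix.inner_toEuclideanCLM]
    rwa [star_trivial, Matrix.sub_mulVec, dotProduct_sub, Algebra.algebraMap_eq_smul_one,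
      Matrix.smul_mulVec, Matrix.one_mulVec, dotProduct_smul, smul_eq_mul, e] at h1
  have h3 : lambdaMax M * ‖x‖ ^ 2 ≤ lambdaMaxPos M * ‖x‖ ^ 2 := by
    gcongr; exact le_max_left _ _
  linarith

theorem lambdaMaxPos_le {M : Matrix (Fin p) (Fin p) ℝ} {b : ℝ} (hb : 0 ≤ b)
    (h : ∀ x, ⟪x, toCLM M x⟫ ≤ b * ‖x‖ ^ 2) : lambdaMaxPos M ≤ b := by
  refine max_le (Real.sSup_le (fun l hl => ?_) hb) hb
  rw [← Matrix.spectrum_toLpLin 2] at hl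
  obtain ⟨v, hv⟩ := (Module.End.hasEigenvalue_iff_mem_spectrum.2 hl).exists_hasEigenvector
  have h1 : toCLM M v = l • v := hv.apply_eq_smul
  have h2 := h v
  rw [h1, real_inner_smul_right, real_inner_self_eq_norm_sq] at h2
  exact le_of_mul_le_mul_right h2 (pow_pos (norm_pos_iff.2 hv.2) 2)

theorem inner_toCLM_scatter (x : Fin n → Vec p) (w : Fin n → ℝ) (m y : Vec p) :
    ⟪y, toCLM (scatter x w m) y⟫ = ∑ i, w i * ⟪y, x i - m⟫ ^ 2 := by
  have h : ∀ z : Vec p,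
      dotProduct y.ofLp ((Matrix.vecMulVec z.ofLp z.ofLp).mulVec y.ofLp) = ⟪y, z⟫ ^ 2 := by
    intro z
    rw [Matrix.vecMulVec_mulVec, dotProduct_smul, sq]
    simp [PiLp.inner_apply, dotProduct, mul_comm]
  rw [Matrix.inner_toEuclideanCLM, scatter, Matrix.sum_mulVec, dotProduct_sum]
  refine Finset.sum_congr rfl fun i _ => ?_
  rw [Matrix.smul_mulVec, dotProduct_smul, h, smul_eq_mul]

theorem isHermitian_scatter (x : Fin n → Vec p) (w : Fin n → ℝ) (m : Vec p) :
    (scatter x w m).IsHermitian := by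
  ext a b
  simp [scatter, Matrix.sum_apply, Matrix.vecMulVec_apply, mul_comm]

theorem inner_toCLM_sqrt {S : Matrix (Fin p) (Fin p) ℝ} (x y : Vec p) :
    ⟪x, toCLM (CFC.sqrt S) y⟫ = ⟪toCLM (CFC.sqrt S) x, y⟫ := by
  have hH : (CFC.sqrt S).IsHermitian := (Matrix.nonneg_iff_posSemidef.1 (CFC.sqrt_nonneg S)).1
  rw [real_inner_comm y, Matrix.inner_toEuclideanCLM, Matrix.inner_toEuclideanCLM,
    Matrix.dotProduct_mulVec, ← Matrix.mulVec_transpose, dotProduct_comm,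
    ← Matrix.conjTranspose_eq_transpose_of_trivial, hH.eq]

theorem norm_toCLM_sqrt_sq {S : Matrix (Fin p) (Fin p) ℝ} (hS : S.PosSemidef) (x : Vec p) :
    ‖toCLM (CFC.sqrt S) x‖ ^ 2 = ⟪x, toCLM S x⟫ := by
  have hm : toCLM (CFC.sqrt S * CFC.sqrt S) = toCLM (CFC.sqrt S) * toCLM (CFC.sqrt S) :=
    map_mul _ _ _
  conv_rhs => rw [← CFC.sqrt_mul_sqrt_self S hS.nonneg]
  rw [hm, ← real_inner_self_eq_norm_sq, ← inner_toCLM_sqrt]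
  rfl

theorem norm_toCLM_sqrt_le {S : Matrix (Fin p) (Fin p) ℝ} (hS : S.PosSemidef) (x : Vec p) :
    ‖toCLM (CFC.sqrt S) x‖ ≤ √(opNorm S) * ‖x‖ := by
  refine (abs_le_of_sq_le_sq' ?_ (by positivity)).2
  rw [norm_toCLM_sqrt_sq hS, mul_pow, opNorm, Real.sq_sqrt (norm_nonneg _), ← opNorm]
  calc ⟪x, toCLM S x⟫ ≤ ‖x‖ * ‖toCLM S x‖ := real_inner_le_norm _ _
    _ ≤ ‖x‖ * (opNorm S * ‖x‖) := by gcongr; exact (toCLM S).le_opNorm x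
    _ = _ := by ring

theorem sum_norm_toCLM_sqrt_single_sq {S : Matrix (Fin p) (Fin p) ℝ} (hS : S.PosSemidef) :
    ∑ a, ‖toCLM (CFC.sqrt S) (EuclideanSpace.single a 1)‖ ^ 2 = S.trace := by
  refine Finset.sum_congr rfl fun a _ => ?_
  rw [norm_toCLM_sqrt_sq hS, EuclideanSpace.inner_single_left]
  simp [Matrix.ofLp_toEuclideanCLM]

theorem opNorm_pos {S : Matrix (Fin p) (Fin p) ℝ} (hS : S ≠ 0) : 0 < opNorm S :=
  norm_pos_iff.2 (by simpa using hS)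

theorem trace_pos {S : Matrix (Fin p) (Fin p) ℝ} (hS : S.PosSemidef) (h0 : S ≠ 0) :
    0 < S.trace :=
  hS.trace_nonneg.lt_of_ne fun h => h0 (hS.trace_eq_zero_iff.1 h.symm)

end Matrices

/-! ### Weights that are bounded by a multiple of the uniform weights -/

section Flat

variable {n p : ℕ} {C ε κ : ℝ} {ξ : Fin n → Vec p}

/-- Probability vectors whose entries are at most `1 / (n (1 - 2 ε))`. -/
structure IsFlat (ε : ℝ) (u : Fin n → ℝ) : Prop where
  nonneg : ∀ i, 0 ≤ u i
  le : ∀ i, u i ≤ 1 / (1 - 2 * ε) / n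
  sum_eq : ∑ i, u i = 1

/-- The statistical rate `√κ + ε √(log (1 / ε))`: the first term is the error without outliers,
the second one the price of contamination. -/
noncomputable def rate (ε κ : ℝ) : ℝ := √κ + ε * √(Real.log (1 / ε))

theorem rate_nonneg (hε : 0 < ε) : 0 ≤ rate ε κ := by unfold rate; positivity

theorem one_le_log_one_div (hε : 0 < ε) (hε' : ε ≤ 7 / 25) : 1 ≤ Real.log (1 / ε) := by
  rw [Real.le_log_iff_exp_le (by positivity), le_div_iff₀ hε]
  nlinarith [Real.exp_one_lt_d9]

theorem le_rate (hε : 0 < ε) (hε' : ε ≤ 7 / 25) : ε ≤ rate ε κ := by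
  have h1 : 1 ≤ √(Real.log (1 / ε)) := by
    rw [Real.one_le_sqrt]; exact one_le_log_one_div hε hε'
  have := Real.sqrt_nonneg κ
  rw [rate]; nlinarith

theorem le_rate_sq (hε : 0 < ε) (hκ : 0 ≤ κ) : κ ≤ rate ε κ ^ 2 := by
  have h : √κ ≤ rate ε κ := by
    rw [rate]; have : 0 ≤ ε * √(Real.log (1 / ε)) := by positivity
    linarith
  calc κ = √κ ^ 2 := (Real.sq_sqrt hκ).symm
    _ ≤ _ := by gcongr

theorem sq_mul_log_le_rate_sq (hε : 0 < ε) (hε' : ε ≤ 7 / 25) :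
    ε ^ 2 * Real.log (1 / ε) ≤ rate ε κ ^ 2 := by
  have hL := one_le_log_one_div hε hε'
  have h : ε * √(Real.log (1 / ε)) ≤ rate ε κ := by
    rw [rate]; have := Real.sqrt_nonneg κ; linarith
  calc ε ^ 2 * Real.log (1 / ε) = (ε * √(Real.log (1 / ε))) ^ 2 := by
        rw [mul_pow, Real.sq_sqrt (by linarith)]
    _ ≤ _ := by gcongr

namespace IsFlat

variable {u : Fin n → ℝ}

/-- The weights `u` are the uniform weights `1 / (n (1 - 2 ε))` minus weights of total mass
`2 ε / (1 - 2 ε)`; the latter are what the third property of a regular sample is about. -/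
theorem exists_sum_eq_sub (hu : IsFlat ε u) (hn : 0 < n) (hε : 0 < ε) (hε' : ε ≤ 7 / 25) :
    ∃ (c : ℝ) (r : Fin n → ℝ), 1 ≤ c ∧ c ≤ 5 / 2 ∧ c - 1 ≤ 5 * ε ∧ (∀ i, 0 ≤ r i ∧ r i ≤ c / n) ∧
      (∑ i, r i = c - 1) ∧ ∀ i, u i = c / n - r i := by
  have h2 : 0 < 1 - 2 * ε := by linarith
  have hc : 1 / (1 - 2 * ε) ≤ 5 / 2 := by rw [div_le_iff₀ h2]; linarith
  refine ⟨1 / (1 - 2 * ε), fun i => 1 / (1 - 2 * ε) / n - u i, ?_, hc, ?_,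
    fun i => ⟨sub_nonneg.2 (hu.le i), by linarith [hu.nonneg i]⟩, ?_, fun i => by ring⟩
  · rw [le_div_iff₀ h2]; linarith
  · have : 1 / (1 - 2 * ε) - 1 = 2 * ε * (1 / (1 - 2 * ε)) := by field_simp; ring
    rw [this]; nlinarith
  · rw [Finset.sum_sub_distrib, hu.sum_eq]
    have : (n : ℝ) ≠ 0 := by positivity
    simp; field_simp

theorem abs_sum_mul_inner_sq_sub_le (hu : IsFlat ε u) (hR : IsRegularSample C ε κ ξ)
    (hn : 0 < n) (hC : 0 ≤ C) (hε : 0 < ε) (hε' : ε ≤ 7 / 25) (hκ : 0 ≤ κ) (hκ2 : κ ≤ 2)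
    (x : Vec p) :
    |∑ i, u i * ⟪x, ξ i⟫ ^ 2 - ‖x‖ ^ 2| ≤
      (8 * C + 5) * (√κ + ε * Real.log (1 / ε)) * ‖x‖ ^ 2 := by
  obtain ⟨c, r, hc1, hc2, hc3, hr, hrs, hur⟩ := hu.exists_sum_eq_sub hn hε hε'
  have hn' : (0 : ℝ) < n := by exact_mod_cast hn
  have hL := one_le_log_one_div hε hε'
  have hκs : κ ≤ 2 * √κ := by
    have h1 : √κ ≤ 2 := by rw [Real.sqrt_le_left (by norm_num)]; linarith
    nlinarith [Real.mul_self_sqrt hκ, Real.sqrt_nonneg κ]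
  have e : ∑ i, u i * ⟪x, ξ i⟫ ^ 2 - ‖x‖ ^ 2 = c / n * (∑ i, ⟪x, ξ i⟫ ^ 2 - n * ‖x‖ ^ 2) +
      (c - 1) * ‖x‖ ^ 2 - ∑ i, r i * ⟪x, ξ i⟫ ^ 2 := by
    simp_rw [hur, sub_mul, Finset.sum_sub_distrib, ← Finset.mul_sum]
    field_simp
    ring
  have b1 := hR.abs_sum_inner_sq_sub_le x
  have b2 := hR.sum_mul_inner_sq_le r c hr x
  have b3 : 0 ≤ ∑ i, r i * ⟪x, ξ i⟫ ^ 2 :=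
    Finset.sum_nonneg fun i _ => mul_nonneg (hr i).1 (sq_nonneg _)
  have hx := sq_nonneg ‖x‖
  have b1' : |c / n * (∑ i, ⟪x, ξ i⟫ ^ 2 - n * ‖x‖ ^ 2)| ≤ 5 / 2 * (C * √κ) * ‖x‖ ^ 2 := by
    rw [abs_mul, abs_of_nonneg (by positivity)]
    calc _ ≤ c / n * (C * n * √κ * ‖x‖ ^ 2) := by gcongr
      _ = c * ((C * √κ) * ‖x‖ ^ 2) := by field_simp
      _ ≤ 5 / 2 * ((C * √κ) * ‖x‖ ^ 2) := by gcongr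
      _ = _ := by ring
  have b2' : ∑ i, r i * ⟪x, ξ i⟫ ^ 2 ≤
      C * (Real.log (1 / ε) * (5 * ε) + 5 / 2 * (ε * Real.log (1 / ε) + 2 * √κ)) * ‖x‖ ^ 2 := by
    refine b2.trans ?_
    rw [hrs]
    have : ε ≤ ε * Real.log (1 / ε) := le_mul_of_one_le_right hε.le hL
    gcongr
  have b4 : (c - 1) * ‖x‖ ^ 2 ≤ 5 * (ε * Real.log (1 / ε)) * ‖x‖ ^ 2 := by
    gcongr
    exact hc3.trans (by have : ε ≤ ε * Real.log (1 / ε) := le_mul_of_one_le_right hε.le hL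
                        linarith)
  have b5 : 0 ≤ (c - 1) * ‖x‖ ^ 2 := mul_nonneg (by linarith) hx
  have p1 : 0 ≤ C * √κ * ‖x‖ ^ 2 := by positivity
  have p2 : 0 ≤ C * (ε * Real.log (1 / ε)) * ‖x‖ ^ 2 := by positivity
  have p3 : 0 ≤ √κ * ‖x‖ ^ 2 := by positivity
  have p4 : 0 ≤ (ε * Real.log (1 / ε)) * ‖x‖ ^ 2 := by positivity
  obtain ⟨b1l, b1r⟩ := abs_le.1 b1'
  rw [e, abs_le]
  constructor <;> linarith

theorem norm_sum_smul_le (hu : IsFlat ε u) (hR : IsRegularSample C ε κ ξ)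
    (hn : 0 < n) (hC : 0 ≤ C) (hε : 0 < ε) (hε' : ε ≤ 7 / 25) (hκ : 0 ≤ κ) :
    ‖∑ i, u i • ξ i‖ ≤ (53 * C + 1) * rate ε κ := by
  obtain ⟨c, r, hc1, hc2, hc3, hr, hrs, hur⟩ := hu.exists_sum_eq_sub hn hε hε'
  have hn' : (0 : ℝ) < n := by exact_mod_cast hn
  have hL := one_le_log_one_div hε hε'
  have hE := rate_nonneg (κ := κ) hε
  have hEκ : √κ ≤ rate ε κ := Real.sqrt_le_iff.2 ⟨hE, le_rate_sq hε hκ⟩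
  set x := ∑ i, u i • ξ i with hx
  have e : ‖x‖ ^ 2 = c / n * ⟪x, ∑ i, ξ i⟫ - ∑ i, r i * ⟪x, ξ i⟫ := by
    rw [← real_inner_self_eq_norm_sq]
    conv_lhs => rw [hx]
    rw [← hx, sum_inner, inner_sum, Finset.mul_sum, ← Finset.sum_sub_distrib]
    refine Finset.sum_congr rfl fun i _ => ?_
    rw [real_inner_smul_left, real_inner_comm x, hur]
    ring
  have b1 : c / n * ⟪x, ∑ i, ξ i⟫ ≤ 5 / 2 * (C * rate ε κ) * ‖x‖ := by
    calc c / n * ⟪x, ∑ i, ξ i⟫ ≤ c / n * (‖x‖ * (C * n * √κ)) := by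
          gcongr
          exact (real_inner_le_norm _ _).trans (by gcongr; exact hR.norm_sum_le)
      _ = c * (C * √κ * ‖x‖) := by field_simp
      _ ≤ 5 / 2 * (C * rate ε κ * ‖x‖) := by gcongr
      _ = _ := by ring
  have b2 : (∑ i, r i * ⟪x, ξ i⟫) ^ 2 ≤ ((50 * C + 1) * rate ε κ * ‖x‖) ^ 2 := by
    calc (∑ i, r i * ⟪x, ξ i⟫) ^ 2 ≤ (∑ i, r i) * ∑ i, r i * ⟪x, ξ i⟫ ^ 2 :=
          Finset.sum_sq_le_sum_mul_sum_of_sq_le_mul _ (fun i _ => (hr i).1)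
            (fun i _ => mul_nonneg (hr i).1 (sq_nonneg _)) fun i _ => (by ring : _ = _).le
      _ ≤ (5 * ε) * (C * (Real.log (1 / ε) * (5 * ε) +
            5 / 2 * (ε * Real.log (1 / ε) + κ)) * ‖x‖ ^ 2) := by
          have h0 : 0 ≤ ∑ i, r i := Finset.sum_nonneg fun i _ => (hr i).1
          have h1 : ∑ i, r i ≤ 5 * ε := hrs.le.trans hc3
          have h2 : ε ≤ ε * Real.log (1 / ε) := le_mul_of_one_le_right hε.le hL
          have h3 : 0 ≤ ∑ i, r i * ⟪x, ξ i⟫ ^ 2 :=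
            Finset.sum_nonneg fun i _ => mul_nonneg (hr i).1 (sq_nonneg _)
          refine mul_le_mul h1 ((hR.sum_mul_inner_sq_le r c hr x).trans ?_) h3 (by positivity)
          gcongr
      _ = C * (75 / 2 * (ε ^ 2 * Real.log (1 / ε)) + 25 / 2 * (ε * κ)) * ‖x‖ ^ 2 := by ring
      _ ≤ C * (75 / 2 * rate ε κ ^ 2 + 25 / 2 * (1 * rate ε κ ^ 2)) * ‖x‖ ^ 2 := by
          have h1 := sq_mul_log_le_rate_sq (κ := κ) hε hε'
          have h2 := le_rate_sq hε hκ
          gcongr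
          linarith
      _ = 50 * C * (rate ε κ ^ 2 * ‖x‖ ^ 2) := by ring
      _ ≤ (50 * C + 1) ^ 2 * (rate ε κ ^ 2 * ‖x‖ ^ 2) := by gcongr; nlinarith
      _ = _ := by ring
  have b3 := (abs_le_of_sq_le_sq' b2 (by positivity)).1
  rcases (norm_nonneg x).eq_or_lt with h0 | h0
  · rw [← h0]; positivity
  · refine le_of_mul_le_mul_right ?_ h0
    have p1 : 0 ≤ C * rate ε κ * ‖x‖ := by positivity
    nlinarith

end IsFlat

end Flat

/-! ### One reweighting step -/

/-- If the weights of the indices in `I` sum to `ρ`, then the distance between the weighted mean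
of all the numbers and the weighted mean over `I` is controlled by the excess of the weighted
second moment around an arbitrary point `t` over the part of the variance coming from `I`. -/
theorem mul_sub_sq_le_of_weighted {ι : Type*} [Fintype ι] [DecidableEq ι] {w : ι → ℝ}
    (hw : ∀ i, 0 ≤ w i) (hw1 : ∑ i, w i = 1) (I : Finset ι) {ρ : ℝ} (hρ : ∑ i ∈ I, w i = ρ)
    (a : ι → ℝ) {A₁ : ℝ} (hA₁ : ∑ i ∈ I, w i * a i = ρ * A₁) (t : ℝ) :
    ρ * (∑ i, w i * a i - A₁) ^ 2 ≤
      (1 - ρ) * (∑ i, w i * (a i - t) ^ 2 - ∑ i ∈ I, w i * (a i - A₁) ^ 2) := by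
  set A := ∑ i, w i * a i with hA
  have hρc : ∑ i ∈ Iᶜ, w i = 1 - ρ := by
    rw [← hw1, ← hρ, ← Finset.sum_add_sum_compl I]; ring
  have hAc : ∑ i ∈ Iᶜ, w i * a i = A - ρ * A₁ := by
    rw [hA, ← hA₁, ← Finset.sum_add_sum_compl I]; ring
  have hρ1 : 0 ≤ 1 - ρ := hρc ▸ Finset.sum_nonneg fun i _ => hw i
  have h1 : ∑ i, w i * (a i - t) ^ 2 = ∑ i, w i * (a i - A) ^ 2 + (A - t) ^ 2 := by
    have e : ∀ i, w i * (a i - t) ^ 2 = w i * (a i - A) ^ 2 + 2 * (A - t) * (w i * a i) +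
        (t ^ 2 - A ^ 2) * w i := fun i => by ring
    simp_rw [e, Finset.sum_add_distrib, ← Finset.mul_sum, hw1, ← hA]
    ring
  have h2 : ∑ i ∈ I, w i * (a i - A) ^ 2 =
      ∑ i ∈ I, w i * (a i - A₁) ^ 2 + ρ * (A - A₁) ^ 2 := by
    have e : ∀ i, w i * (a i - A) ^ 2 = w i * (a i - A₁) ^ 2 + 2 * (A₁ - A) * (w i * a i) +
        (A ^ 2 - A₁ ^ 2) * w i := fun i => by ring
    simp_rw [e, Finset.sum_add_distrib, ← Finset.mul_sum, hρ, hA₁]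
    ring
  have h3 : (ρ * (A - A₁)) ^ 2 ≤ (1 - ρ) * ∑ i ∈ Iᶜ, w i * (a i - A) ^ 2 := by
    have e : ∑ i ∈ Iᶜ, w i * (a i - A) = ρ * (A - A₁) := by
      simp_rw [mul_sub, Finset.sum_sub_distrib, hAc, ← Finset.sum_mul, hρc]
      ring
    rw [← e, ← hρc]
    exact Finset.sum_sq_le_sum_mul_sum_of_sq_le_mul _ (fun i _ => hw i)
      (fun i _ => mul_nonneg (hw i) (sq_nonneg _)) fun i _ => (by ring : _ = _).le
  have h4 := Finset.sum_add_sum_compl I fun i => w i * (a i - A) ^ 2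
  have h5 : 0 ≤ (1 - ρ) * (A - t) ^ 2 := by positivity
  rw [h1, ← h4, h2]
  nlinarith

section Step

variable {n p : ℕ} {C ε κ : ℝ} {ξ X : Fin n → Vec p} {S : Matrix (Fin p) (Fin p) ℝ} {μ : Vec p}
  {I : Finset (Fin n)}

/-- The contraction factor of a reweighting step. -/
noncomputable def contraction (ε : ℝ) : ℝ := √(ε * (1 - ε)) / (1 - 2 * ε)

theorem wmean_eq_add {u : Fin n → ℝ} (hu : ∑ i, u i = 1) (h0 : ∀ i ∉ I, u i = 0)
    (hX : ∀ i ∈ I, X i = μ + toCLM (CFC.sqrt S) (ξ i)) :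
    wmean X u = μ + toCLM (CFC.sqrt S) (∑ i, u i • ξ i) := by
  have h : ∀ i, u i • X i = u i • μ + toCLM (CFC.sqrt S) (u i • ξ i) := by
    intro i
    by_cases hi : i ∈ I
    · rw [hX i hi, smul_add, map_smul]
    · simp [h0 i hi]
  simp_rw [wmean, h, Finset.sum_add_distrib, ← Finset.sum_smul, hu, one_smul, map_sum]

/-- The uniform weights on the inliers show that the minimal cost around `m` is governed by the
distance from `m` to the mean of the inliers. -/
theorem exists_weights_cost_le (hS : S.PosSemidef) (hR : IsRegularSample C ε κ ξ) (hn : 0 < n)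
    (hC : 0 ≤ C) (hε : 0 < ε) (hε' : ε ≤ 7 / 25) (hκ : 0 ≤ κ) (hκ2 : κ ≤ 2)
    (hX : ∀ i ∈ I, X i = μ + toCLM (CFC.sqrt S) (ξ i)) (hI : (n : ℝ) - n * ε ≤ I.card)
    (m : Vec p) :
    ∃ w ∈ weights n ε, cost S X w m ≤
      (‖m - μ‖ + √(opNorm S) * ((53 * C + 1) * rate ε κ)) ^ 2 +
        opNorm S * ((8 * C + 5) * (√κ + ε * Real.log (1 / ε))) := by
  classical
  have hn' : (0 : ℝ) < n := by exact_mod_cast hn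
  have hIpos : (0 : ℝ) < I.card := lt_of_lt_of_le (by nlinarith) hI
  have hL := one_le_log_one_div hε hε'
  set u : Fin n → ℝ := fun i => if i ∈ I then 1 / (I.card : ℝ) else 0 with hu
  have hu0 : ∀ i, 0 ≤ u i := fun i => by simp only [hu]; split_ifs <;> positivity
  have hu1 : ∑ i, u i = 1 := by simp [hu, hIpos.ne']
  have hle : ∀ i, u i ≤ 1 / ((n : ℝ) - n * ε) := fun i => by
    have hpos : 0 < (n : ℝ) - n * ε := by nlinarith
    simp only [hu]; split_ifs
    · gcongr
    · positivity
  have hflat : IsFlat ε u := by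
    refine ⟨hu0, fun i => (hle i).trans ?_, hu1⟩
    rw [div_div]
    have : 0 < (1 - 2 * ε) * n := mul_pos (by linarith) hn'
    gcongr
    nlinarith
  refine ⟨u, ⟨⟨hu0, hu1⟩, hle⟩, lambdaMaxPos_le ?_ fun x => ?_⟩
  · have : 0 ≤ opNorm S := norm_nonneg _
    positivity
  set B := toCLM (CFC.sqrt S) with hB
  set z := ∑ i, u i • ξ i with hz
  have hq : ⟪x, toCLM (scatter X u m - S) x⟫ =
      ∑ i, u i * ⟪x, X i - m⟫ ^ 2 - ‖B x‖ ^ 2 := by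
    have : toCLM (scatter X u m - S) = toCLM (scatter X u m) - toCLM S := map_sub _ _ _
    rw [this, sub_apply, inner_sub_right, inner_toCLM_scatter, norm_toCLM_sqrt_sq hS]
  have hinner : ∀ i, u i * ⟪x, X i - m⟫ ^ 2 = u i * (⟪B x, ξ i⟫ + ⟪x, μ - m⟫) ^ 2 := by
    intro i
    by_cases hi : i ∈ I
    · rw [hX i hi, add_sub_right_comm, inner_add_right, inner_toCLM_sqrt, add_comm]
    · simp [hu, hi]
  have hexp : ∑ i, u i * (⟪B x, ξ i⟫ + ⟪x, μ - m⟫) ^ 2 =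
      ∑ i, u i * ⟪B x, ξ i⟫ ^ 2 - ⟪B x, z⟫ ^ 2 + (⟪x, μ - m⟫ + ⟪B x, z⟫) ^ 2 := by
    have e : ∀ i, u i * (⟪B x, ξ i⟫ + ⟪x, μ - m⟫) ^ 2 = u i * ⟪B x, ξ i⟫ ^ 2 +
        2 * ⟪x, μ - m⟫ * (u i * ⟪B x, ξ i⟫) + ⟪x, μ - m⟫ ^ 2 * u i := fun i => by ring
    have e2 : ∑ i, u i * ⟪B x, ξ i⟫ = ⟪B x, z⟫ := by
      rw [hz, inner_sum]; simp_rw [real_inner_smul_right]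
    simp_rw [e, Finset.sum_add_distrib, ← Finset.mul_sum, hu1, e2]
    ring
  have b1 := (abs_le.1 (hflat.abs_sum_mul_inner_sq_sub_le hR hn hC hε hε' hκ hκ2 (B x))).2
  have b2 := hflat.norm_sum_smul_le hR hn hC hε hε' hκ
  have hBx := norm_toCLM_sqrt_le hS x
  have hBx2 : ‖B x‖ ^ 2 ≤ opNorm S * ‖x‖ ^ 2 := by
    calc _ ≤ (√(opNorm S) * ‖x‖) ^ 2 := by gcongr
      _ = _ := by rw [mul_pow, opNorm, Real.sq_sqrt (norm_nonneg _)]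
  have b3 : (⟪x, μ - m⟫ + ⟪B x, z⟫) ^ 2 ≤
      ((‖m - μ‖ + √(opNorm S) * ((53 * C + 1) * rate ε κ)) * ‖x‖) ^ 2 := by
    rw [← sq_abs]
    gcongr
    refine (abs_add_le _ _).trans ?_
    have c1 : |⟪x, μ - m⟫| ≤ ‖x‖ * ‖m - μ‖ := by
      rw [norm_sub_rev]; exact abs_real_inner_le_norm _ _
    have c2 : |⟪B x, z⟫| ≤ √(opNorm S) * ‖x‖ * ((53 * C + 1) * rate ε κ) :=
      (abs_real_inner_le_norm _ _).trans (by gcongr)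
    linarith
  have b4 : (8 * C + 5) * (√κ + ε * Real.log (1 / ε)) * ‖B x‖ ^ 2 ≤
      (8 * C + 5) * (√κ + ε * Real.log (1 / ε)) * (opNorm S * ‖x‖ ^ 2) := by gcongr
  rw [hq, Finset.sum_congr rfl fun i _ => hinner i, hexp]
  nlinarith [sq_nonneg ⟪B x, z⟫]

/-- The weights `w` restricted to `I` and renormalized. -/
noncomputable def restrictWeights (I : Finset (Fin n)) (w : Fin n → ℝ) : Fin n → ℝ :=
  open Classical in fun i => if i ∈ I then w i / ∑ j ∈ I, w j else 0

theorem restrictWeights_of_notMem {w : Fin n → ℝ} {i : Fin n} (hi : i ∉ I) :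
    restrictWeights I w i = 0 := by
  simp [restrictWeights, hi]

theorem sum_mul_eq_mul_sum_restrictWeights {w : Fin n → ℝ} (h : ∑ i ∈ I, w i ≠ 0)
    (f : Fin n → ℝ) :
    ∑ i ∈ I, w i * f i = (∑ i ∈ I, w i) * ∑ i, restrictWeights I w i * f i := by
  rw [Finset.mul_sum, ← Finset.sum_subset (Finset.subset_univ I)]
  · refine Finset.sum_congr rfl fun i hi => ?_
    simp only [restrictWeights, if_pos hi]; field_simp
  · intro i _ hi; simp [restrictWeights_of_notMem hi]

theorem sum_restrictWeights {w : Fin n → ℝ} (h : ∑ i ∈ I, w i ≠ 0) :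
    ∑ i, restrictWeights I w i = 1 := by
  have := sum_mul_eq_mul_sum_restrictWeights h fun _ => 1
  simp only [mul_one] at this
  exact (mul_right_eq_self₀.1 this.symm).resolve_right h

/-- Admissible weights give mass at most `ε / (1 - ε)` to the outliers. -/
theorem one_sub_sum_le {w : Fin n → ℝ} (hw : w ∈ weights n ε) (hn : 0 < n)
    (hε : 0 < ε) (hε' : ε ≤ 7 / 25) (hI : (n : ℝ) - n * ε ≤ I.card) :
    1 - ∑ i ∈ I, w i ≤ ε / (1 - ε) := by
  classical
  obtain ⟨⟨hw0, hw1⟩, hwle⟩ := hw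
  have hn' : (0 : ℝ) < n := by exact_mod_cast hn
  have hIc : (Iᶜ.card : ℝ) ≤ n * ε := by
    have : (I.card : ℝ) + Iᶜ.card = n := by
      exact_mod_cast (Finset.card_add_card_compl I).trans (Fintype.card_fin n)
    linarith
  have e : 1 - ∑ i ∈ I, w i = ∑ i ∈ Iᶜ, w i := by
    rw [← hw1, ← Finset.sum_add_sum_compl I w]; ring
  rw [e]
  have hpos : 0 < (n : ℝ) - n * ε := by nlinarith
  calc ∑ i ∈ Iᶜ, w i ≤ Iᶜ.card • (1 / ((n : ℝ) - n * ε)) :=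
        Finset.sum_le_card_nsmul _ _ _ fun i _ => hwle i
    _ = Iᶜ.card * (1 / ((n : ℝ) - n * ε)) := by rw [nsmul_eq_mul]
    _ ≤ n * ε * (1 / ((n : ℝ) - n * ε)) := by gcongr
    _ = ε / (1 - ε) := by
        have : (1 - ε) ≠ 0 := by linarith
        field_simp

theorem div_le_sum {w : Fin n → ℝ} (hw : w ∈ weights n ε) (hn : 0 < n)
    (hε : 0 < ε) (hε' : ε ≤ 7 / 25) (hI : (n : ℝ) - n * ε ≤ I.card) :
    (1 - 2 * ε) / (1 - ε) ≤ ∑ i ∈ I, w i := by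
  have h1ε : 1 - ε ≠ 0 := by linarith
  have : (1 - 2 * ε) / (1 - ε) = 1 - ε / (1 - ε) := by field_simp; ring
  linarith [one_sub_sum_le hw hn hε hε' hI]

theorem isFlat_restrictWeights {w : Fin n → ℝ} (hw : w ∈ weights n ε) (hn : 0 < n)
    (hε : 0 < ε) (hε' : ε ≤ 7 / 25) (hI : (n : ℝ) - n * ε ≤ I.card) :
    IsFlat ε (restrictWeights I w) := by
  have h1ε : 0 < 1 - ε := by linarith
  have h2ε : 0 < 1 - 2 * ε := by linarith
  have hn' : (0 : ℝ) < n := by exact_mod_cast hn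
  have hρ := div_le_sum hw hn hε hε' hI
  have hρ0 : 0 < ∑ i ∈ I, w i := lt_of_lt_of_le (by positivity) hρ
  refine ⟨fun i => ?_, fun i => ?_, sum_restrictWeights hρ0.ne'⟩
  · simp only [restrictWeights]; split_ifs
    exacts [div_nonneg (hw.1.1 i) hρ0.le, le_rfl]
  · simp only [restrictWeights]; split_ifs
    · rw [div_le_iff₀ hρ0]
      refine (hw.2 i).trans ?_
      calc 1 / ((n : ℝ) - n * ε) = 1 / (n * (1 - ε)) := by ring
        _ = 1 / (1 - 2 * ε) / n * ((1 - 2 * ε) / (1 - ε)) := by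
            have h := h2ε.ne'
            generalize 1 - 2 * ε = s at h
            field_simp
        _ ≤ _ := by gcongr
    · positivity

/-- The squared distance between the weighted mean and the weighted mean of the inliers. -/
theorem norm_wmean_sub_wmean_restrictWeights_sq_le (hS : S.PosSemidef)
    (hR : IsRegularSample C ε κ ξ) (hn : 0 < n)
    (hC : 0 ≤ C) (hε : 0 < ε) (hε' : ε ≤ 7 / 25) (hκ : 0 ≤ κ)
    (hκ2 : κ ≤ 2) (hX : ∀ i ∈ I, X i = μ + toCLM (CFC.sqrt S) (ξ i))
    (hI : (n : ℝ) - n * ε ≤ I.card) (m : Vec p) {w : Fin n → ℝ} (hw : w ∈ weights n ε) :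
    ‖wmean X w - wmean X (restrictWeights I w)‖ ^ 2 ≤ ε / (1 - 2 * ε) * (cost S X w m +
      opNorm S * (2 * ε + (8 * C + 5) * (√κ + ε * Real.log (1 / ε)) +
        ((53 * C + 1) * rate ε κ) ^ 2)) := by
  classical
  have hn' : (0 : ℝ) < n := by exact_mod_cast hn
  have hL := one_le_log_one_div hε hε'
  have hE := rate_nonneg (κ := κ) hε
  have hS0 : 0 ≤ opNorm S := norm_nonneg _
  have hcost0 : 0 ≤ cost S X w m := le_max_right _ _
  have h1ε : 0 < 1 - ε := by linarith
  have h2ε : 0 < 1 - 2 * ε := by linarith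
  have hρ' := one_sub_sum_le hw hn hε hε' hI
  have hρlow := div_le_sum hw hn hε hε' hI
  have hflat := isFlat_restrictWeights hw hn hε hε' hI
  obtain ⟨⟨hw0, hw1⟩, hwle⟩ := hw
  have hρle : ∑ i ∈ I, w i ≤ 1 := by
    rw [← hw1]; exact Finset.sum_le_univ_sum_of_nonneg hw0
  have hρpos : 0 < ∑ i ∈ I, w i := lt_of_lt_of_le (by positivity) hρlow
  have hwu := sum_mul_eq_mul_sum_restrictWeights (I := I) hρpos.ne'
  have hmean := wmean_eq_add (I := I) hflat.sum_eq (fun i hi => restrictWeights_of_notMem hi) hX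
  generalize restrictWeights I w = u at *
  generalize hρ : ∑ i ∈ I, w i = ρ at *
  have hθ : (1 - ρ) ≤ 2 * ε := hρ'.trans (by rw [div_le_iff₀ h1ε]; nlinarith)
  set B := toCLM (CFC.sqrt S) with hB
  set z := ∑ i, u i • ξ i with hz
  set d := wmean X w - wmean X u with hd
  have hinner : ∀ v : Fin n → ℝ, ∑ i, v i * ⟪d, X i⟫ = ⟪d, wmean X v⟫ := by
    intro v
    rw [wmean, inner_sum]; simp_rw [real_inner_smul_right]
  have hscal := mul_sub_sq_le_of_weighted hw0 hw1 I hρ (fun i => ⟪d, X i⟫)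
    (A₁ := ⟪d, wmean X u⟫) (by rw [hwu, hinner]) ⟪d, m⟫
  rw [hinner, ← inner_sub_right, ← hd, real_inner_self_eq_norm_sq] at hscal
  -- the part of the variance that comes from the inliers
  have hvar : ∑ i ∈ I, w i * (⟪d, X i⟫ - ⟪d, wmean X u⟫) ^ 2 =
      ρ * (∑ i, u i * ⟪B d, ξ i⟫ ^ 2 - ⟪B d, z⟫ ^ 2) := by
    have e0 : ∀ i ∈ I, w i * (⟪d, X i⟫ - ⟪d, wmean X u⟫) ^ 2 =
        w i * (⟪B d, ξ i⟫ - ⟪B d, z⟫) ^ 2 := by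
      intro i hi
      rw [← inner_sub_right, ← inner_sub_right, hX i hi, hmean, add_sub_add_left_eq_sub,
        ← map_sub, inner_toCLM_sqrt]
    rw [Finset.sum_congr rfl e0, hwu]
    congr 1
    have e : ∀ i, u i * (⟪B d, ξ i⟫ - ⟪B d, z⟫) ^ 2 = u i * ⟪B d, ξ i⟫ ^ 2 -
        2 * ⟪B d, z⟫ * (u i * ⟪B d, ξ i⟫) + ⟪B d, z⟫ ^ 2 * u i := fun i => by ring
    have e2 : ∑ i, u i * ⟪B d, ξ i⟫ = ⟪B d, z⟫ := by
      rw [hz, inner_sum]; simp_rw [real_inner_smul_right]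
    simp_rw [e, Finset.sum_add_distrib, Finset.sum_sub_distrib, ← Finset.mul_sum,
      hflat.sum_eq, e2]
    ring
  -- the second moment around `m` is bounded through the cost
  have hsec : ∑ i, w i * (⟪d, X i⟫ - ⟪d, m⟫) ^ 2 ≤ cost S X w m * ‖d‖ ^ 2 + ‖B d‖ ^ 2 := by
    have h1 := inner_toCLM_le_lambdaMaxPos ((isHermitian_scatter X w m).sub hS.1) d
    have h2 : toCLM (scatter X w m - S) = toCLM (scatter X w m) - toCLM S := map_sub _ _ _
    rw [h2, sub_apply, inner_sub_right, inner_toCLM_scatter, ← norm_toCLM_sqrt_sq hS] at h1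
    simp_rw [← inner_sub_right]
    rw [cost]
    linarith
  have b1 := (abs_le.1 (hflat.abs_sum_mul_inner_sq_sub_le hR hn hC hε hε' hκ hκ2 (B d))).1
  have b2 := hflat.norm_sum_smul_le hR hn hC hε hε' hκ
  have hη0 : 0 ≤ (8 * C + 5) * (√κ + ε * Real.log (1 / ε)) := by positivity
  have hη₁0 : 0 ≤ (53 * C + 1) * rate ε κ := by positivity
  generalize (8 * C + 5) * (√κ + ε * Real.log (1 / ε)) = η at *
  generalize (53 * C + 1) * rate ε κ = η₁ at *
  have hBd2 : ‖B d‖ ^ 2 ≤ opNorm S * ‖d‖ ^ 2 := by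
    calc _ ≤ (√(opNorm S) * ‖d‖) ^ 2 := by gcongr; exact norm_toCLM_sqrt_le hS d
      _ = _ := by rw [mul_pow, opNorm, Real.sq_sqrt (norm_nonneg _)]
  have b3 : ⟪B d, z⟫ ^ 2 ≤ η₁ ^ 2 * ‖B d‖ ^ 2 := by
    rw [← mul_pow, ← sq_abs]
    gcongr
    exact (abs_real_inner_le_norm _ _).trans (by rw [mul_comm]; gcongr)
  have b4 : ∑ i, w i * (⟪d, X i⟫ - ⟪d, m⟫) ^ 2 -
      ∑ i ∈ I, w i * (⟪d, X i⟫ - ⟪d, wmean X u⟫) ^ 2 ≤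
      (cost S X w m + opNorm S * (2 * ε + η + η₁ ^ 2)) * ‖d‖ ^ 2 := by
    rw [hvar]
    have c1 : ρ * (‖B d‖ ^ 2 - (η + η₁ ^ 2) * ‖B d‖ ^ 2) ≤
        ρ * (∑ i, u i * ⟪B d, ξ i⟫ ^ 2 - ⟪B d, z⟫ ^ 2) :=
      mul_le_mul_of_nonneg_left (by linarith) hρpos.le
    have c2 : ρ * ((η + η₁ ^ 2) * ‖B d‖ ^ 2) ≤ 1 * ((η + η₁ ^ 2) * ‖B d‖ ^ 2) :=
      mul_le_mul_of_nonneg_right hρle (by positivity)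
    have c3 : (1 - ρ) * ‖B d‖ ^ 2 ≤ 2 * ε * ‖B d‖ ^ 2 :=
      mul_le_mul_of_nonneg_right hθ (by positivity)
    have c4 : (2 * ε + η + η₁ ^ 2) * ‖B d‖ ^ 2 ≤
        (2 * ε + η + η₁ ^ 2) * (opNorm S * ‖d‖ ^ 2) :=
      mul_le_mul_of_nonneg_left hBd2 (by positivity)
    linarith
  have hratio : (1 - ρ) ≤ ε / (1 - 2 * ε) * ρ := by
    calc (1 - ρ) ≤ ε / (1 - ε) := hρ'
      _ = ε / (1 - 2 * ε) * ((1 - 2 * ε) / (1 - ε)) := by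
          have h := h2ε.ne'
          generalize 1 - 2 * ε = s at h
          field_simp
      _ ≤ _ := by gcongr
  have hG : 0 ≤ cost S X w m + opNorm S * (2 * ε + η + η₁ ^ 2) := by positivity
  generalize cost S X w m + opNorm S * (2 * ε + η + η₁ ^ 2) = G at *
  rcases (sq_nonneg ‖d‖).eq_or_lt with h0 | h0
  · rw [← h0]; positivity
  · refine le_of_mul_le_mul_right ?_ (mul_pos hρpos h0)
    calc ‖d‖ ^ 2 * (ρ * ‖d‖ ^ 2) = ρ * (‖d‖ ^ 2) ^ 2 := by ring
      _ ≤ (1 - ρ) * (G * ‖d‖ ^ 2) :=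
          hscal.trans (mul_le_mul_of_nonneg_left b4 (by linarith))
      _ ≤ (ε / (1 - 2 * ε) * ρ) * (G * ‖d‖ ^ 2) := by gcongr
      _ = _ := by ring

/-- The remainder of a reweighting step is of the order of the squared rate: the factor `ε`
turns the deviations of the second moments, of order `√κ + ε log (1 / ε)`, into squares. -/
theorem remainder_le (hC : 0 ≤ C) (hε : 0 < ε) (hε' : ε ≤ 7 / 25) (hκ : 0 ≤ κ) :
    ε / (1 - 2 * ε) * (2 * ε + 2 * ((8 * C + 5) * (√κ + ε * Real.log (1 / ε))) +
      ((53 * C + 1) * rate ε κ) ^ 2) ≤ ((53 * C + 8) * rate ε κ) ^ 2 := by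
  have hL := one_le_log_one_div hε hε'
  have hE := rate_nonneg (κ := κ) hε
  have r0 := le_rate (κ := κ) hε hε'
  have hβ2 : ε / (1 - 2 * ε) ≤ 5 / 2 * ε := by
    rw [div_le_iff₀ (by linarith)]; nlinarith
  have r1 : ε * ε ≤ rate ε κ ^ 2 := by rw [sq]; gcongr
  have r2 : ε * (√κ + ε * Real.log (1 / ε)) ≤ 2 * rate ε κ ^ 2 := by
    have s1 : ε * √κ ≤ rate ε κ * rate ε κ := by
      have : √κ ≤ rate ε κ := Real.sqrt_le_iff.2 ⟨hE, le_rate_sq hε hκ⟩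
      gcongr
    have s2 := sq_mul_log_le_rate_sq (κ := κ) hε hε'
    linarith
  have r3 : 5 / 2 * ε * ((53 * C + 1) * rate ε κ) ^ 2 ≤ 1 * ((53 * C + 1) * rate ε κ) ^ 2 := by
    gcongr; linarith
  calc _ ≤ 5 / 2 * ε * (2 * ε + 2 * ((8 * C + 5) * (√κ + ε * Real.log (1 / ε))) +
      ((53 * C + 1) * rate ε κ) ^ 2) := by gcongr
    _ = 5 * (ε * ε) + 5 * (8 * C + 5) * (ε * (√κ + ε * Real.log (1 / ε))) +
          5 / 2 * ε * ((53 * C + 1) * rate ε κ) ^ 2 := by ring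
    _ ≤ 5 * rate ε κ ^ 2 + 5 * (8 * C + 5) * (2 * rate ε κ ^ 2) +
          1 * ((53 * C + 1) * rate ε κ) ^ 2 := by gcongr
    _ = (55 + 80 * C + (53 * C + 1) ^ 2) * rate ε κ ^ 2 := by ring
    _ ≤ (53 * C + 8) ^ 2 * rate ε κ ^ 2 := by gcongr; nlinarith
    _ = _ := by ring

/-- One step of the algorithm contracts the error, up to a term of the order of the rate. -/
theorem norm_wmean_sub_le (hS : S.PosSemidef) (hR : IsRegularSample C ε κ ξ) (hn : 0 < n)
    (hC : 0 ≤ C) (hε : 0 < ε) (hε' : ε ≤ 7 / 25) (hα : contraction ε ≤ 1) (hκ : 0 ≤ κ)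
    (hκ2 : κ ≤ 2) (hX : ∀ i ∈ I, X i = μ + toCLM (CFC.sqrt S) (ξ i))
    (hI : (n : ℝ) - n * ε ≤ I.card) {m : Vec p} {w : Fin n → ℝ} (hw : w ∈ weights n ε)
    (hmin : ∀ w' ∈ weights n ε, cost S X w m ≤ cost S X w' m) :
    ‖wmean X w - μ‖ ≤ contraction ε * ‖m - μ‖ +
      3 * (53 * C + 8) * √(opNorm S) * rate ε κ := by
  obtain ⟨w', hw', hcost'⟩ := exists_weights_cost_le hS hR hn hC hε hε' hκ hκ2 hX hI m
  have hcost := (hmin w' hw').trans hcost'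
  have hd2 := norm_wmean_sub_wmean_restrictWeights_sq_le hS hR hn hC hε hε' hκ hκ2 hX hI m hw
  have hrem := remainder_le hC hε hε' hκ
  have hflat := isFlat_restrictWeights hw hn hε hε' hI
  have hmean := wmean_eq_add (I := I) hflat.sum_eq (fun i hi => restrictWeights_of_notMem hi) hX
  have hz := hflat.norm_sum_smul_le hR hn hC hε hε' hκ
  have hE := rate_nonneg (κ := κ) hε
  have hL := one_le_log_one_div hε hε'
  have hS0 : 0 ≤ opNorm S := norm_nonneg _
  have hs0 := Real.sqrt_nonneg (opNorm S)
  have h2ε : 0 < 1 - 2 * ε := by linarith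
  have hα0 : 0 ≤ contraction ε := by unfold contraction; positivity
  have hβ : ε / (1 - 2 * ε) ≤ contraction ε ^ 2 := by
    have h1ε : 0 < 1 - ε := by linarith
    rw [contraction, div_pow, Real.sq_sqrt (by positivity), div_le_div_iff₀ h2ε (by positivity)]
    nlinarith [mul_pos (mul_pos hε h2ε) hε]
  have hη₁0 : 0 ≤ (53 * C + 1) * rate ε κ := by positivity
  have hη₁G : (53 * C + 1) * rate ε κ ≤ (53 * C + 8) * rate ε κ := by gcongr; norm_num
  have h1 : ‖wmean X (restrictWeights I w) - μ‖ ≤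
      √(opNorm S) * ((53 * C + 1) * rate ε κ) := by
    rw [hmean, add_sub_cancel_left]
    exact (norm_toCLM_sqrt_le hS _).trans (by gcongr)
  have hη0 : 0 ≤ (8 * C + 5) * (√κ + ε * Real.log (1 / ε)) := by positivity
  have hβ0 : 0 ≤ ε / (1 - 2 * ε) := by positivity
  have h53 : 3 * (53 * C + 8) * √(opNorm S) * rate ε κ =
    3 * (√(opNorm S) * ((53 * C + 8) * rate ε κ)) := by ring
  rw [h53]
  generalize (8 * C + 5) * (√κ + ε * Real.log (1 / ε)) = η at *
  generalize (53 * C + 1) * rate ε κ = η₁ at *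
  generalize (53 * C + 8) * rate ε κ = G at *
  have hG0 : 0 ≤ G := hη₁0.trans hη₁G
  generalize ε / (1 - 2 * ε) = β at *
  generalize contraction ε = α at *
  set s := √(opNorm S) with hs
  have hs2 : opNorm S = s ^ 2 := (Real.sq_sqrt hS0).symm
  have hm0 := norm_nonneg (m - μ)
  generalize ‖m - μ‖ = a at *
  have h2 : ‖wmean X w - wmean X (restrictWeights I w)‖ ≤ α * (a + s * η₁) + s * G := by
    refine (abs_le_of_sq_le_sq' ?_ (by positivity)).2
    calc _ ≤ β * ((a + s * η₁) ^ 2 + opNorm S * (2 * ε + 2 * η + η₁ ^ 2)) := by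
          refine hd2.trans (mul_le_mul_of_nonneg_left ?_ hβ0)
          linarith
      _ = β * (a + s * η₁) ^ 2 + s ^ 2 * (β * (2 * ε + 2 * η + η₁ ^ 2)) := by rw [hs2]; ring
      _ ≤ α ^ 2 * (a + s * η₁) ^ 2 + s ^ 2 * G ^ 2 := by gcongr
      _ ≤ (α * (a + s * η₁) + s * G) ^ 2 := by
          have : 0 ≤ (α * (a + s * η₁)) * (s * G) := by positivity
          linarith
  have h3 : ‖wmean X w - μ‖ ≤ ‖wmean X w - wmean X (restrictWeights I w)‖ +
      ‖wmean X (restrictWeights I w) - μ‖ := norm_sub_le_norm_sub_add_norm_sub _ _ _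
  have h4 : α * (s * η₁) ≤ 1 * (s * G) := by gcongr
  have h5 : s * η₁ ≤ s * G := by gcongr
  linarith

end Step

/-! ### The geometric median and the number of iterations -/

section Deterministic

variable {n p : ℕ} {C ε κ : ℝ} {ξ X : Fin n → Vec p} {S : Matrix (Fin p) (Fin p) ℝ} {μ : Vec p}
  {I : Finset (Fin n)}

/-- The geometric median has breakdown point `1 / 2`. -/
theorem IsGeomMedian.mul_norm_sub_le {m : Vec p} (hm : IsGeomMedian X m)
    (hX : ∀ i ∈ I, X i = μ + toCLM (CFC.sqrt S) (ξ i)) (hI : (n : ℝ) - n * ε ≤ I.card) :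
    (1 - 2 * ε) * n * ‖m - μ‖ ≤ 2 * ∑ i, ‖toCLM (CFC.sqrt S) (ξ i)‖ := by
  classical
  have hpt : ∀ i, ‖X i - μ‖ - ‖X i - m‖ ≤
      2 * ‖toCLM (CFC.sqrt S) (ξ i)‖ + (if i ∈ I then -2 * ‖m - μ‖ else 0) + ‖m - μ‖ := by
    intro i
    split_ifs with hi
    · have h1 : ‖m - μ‖ ≤ ‖X i - m‖ + ‖X i - μ‖ := by
        have := norm_sub_le (X i - μ) (X i - m)
        rw [sub_sub_sub_cancel_left] at this
        linarith
      have h2 : ‖X i - μ‖ = ‖toCLM (CFC.sqrt S) (ξ i)‖ := by rw [hX i hi, add_sub_cancel_left]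
      linarith
    · have h1 : ‖X i - μ‖ ≤ ‖X i - m‖ + ‖m - μ‖ := norm_sub_le_norm_sub_add_norm_sub _ _ _
      have := norm_nonneg (toCLM (CFC.sqrt S) (ξ i))
      linarith
  have h := Finset.sum_le_sum fun i (_ : i ∈ Finset.univ) => hpt i
  rw [Finset.sum_sub_distrib, Finset.sum_add_distrib, Finset.sum_add_distrib, ← Finset.mul_sum]
    at h
  simp only [Finset.sum_ite_mem, Finset.univ_inter, Finset.sum_const, nsmul_eq_mul,
    Finset.card_univ, Fintype.card_fin] at h
  have h3 := hm μ
  have h4 := mul_le_mul_of_nonneg_right hI (norm_nonneg (m - μ))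
  linarith

theorem sum_norm_toCLM_sqrt_sq_le (hS : S.PosSemidef) (hR : IsRegularSample C ε κ ξ) :
    ∑ i, ‖toCLM (CFC.sqrt S) (ξ i)‖ ^ 2 ≤ n * (1 + C * √κ) * S.trace := by
  have h1 : ∀ i, ‖toCLM (CFC.sqrt S) (ξ i)‖ ^ 2 =
      ∑ a, ⟪toCLM (CFC.sqrt S) (EuclideanSpace.single a 1), ξ i⟫ ^ 2 := by
    intro i
    rw [EuclideanSpace.real_norm_sq_eq]
    refine Finset.sum_congr rfl fun a _ => ?_
    rw [← inner_toCLM_sqrt, EuclideanSpace.inner_single_left]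
    simp
  simp_rw [h1]
  rw [Finset.sum_comm, ← sum_norm_toCLM_sqrt_single_sq hS, Finset.mul_sum]
  refine Finset.sum_le_sum fun a _ => ?_
  have := (abs_le.1 (hR.abs_sum_inner_sq_sub_le
    (toCLM (CFC.sqrt S) (EuclideanSpace.single a 1)))).2
  linarith

theorem IsGeomMedian.norm_sub_sq_le {m : Vec p} (hm : IsGeomMedian X m) (hS : S.PosSemidef)
    (hR : IsRegularSample C ε κ ξ) (hn : 0 < n) (hC : 0 ≤ C) (hε' : ε ≤ 7 / 25)
    (hκ2 : κ ≤ 2) (hX : ∀ i ∈ I, X i = μ + toCLM (CFC.sqrt S) (ξ i))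
    (hI : (n : ℝ) - n * ε ≤ I.card) :
    ((1 - 2 * ε) * ‖m - μ‖) ^ 2 ≤ 4 * (1 + 2 * C) * S.trace := by
  have hn' : (0 : ℝ) < n := by exact_mod_cast hn
  have h2ε : 0 < 1 - 2 * ε := by linarith
  have hκ' : √κ ≤ 2 := by rw [Real.sqrt_le_left (by norm_num)]; linarith
  have h1 := hm.mul_norm_sub_le hX hI
  have h2 := sum_norm_toCLM_sqrt_sq_le hS hR
  have h3 := sq_sum_le_card_mul_sum_sq (s := Finset.univ)
    (f := fun i => ‖toCLM (CFC.sqrt S) (ξ i)‖)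
  simp only [Finset.card_univ, Fintype.card_fin] at h3
  have htr := hS.trace_nonneg
  refine le_of_mul_le_mul_left ?_ (pow_pos hn' 2)
  calc (n : ℝ) ^ 2 * ((1 - 2 * ε) * ‖m - μ‖) ^ 2 = ((1 - 2 * ε) * n * ‖m - μ‖) ^ 2 := by ring
    _ ≤ (2 * ∑ i, ‖toCLM (CFC.sqrt S) (ξ i)‖) ^ 2 := by gcongr
    _ = 4 * (∑ i, ‖toCLM (CFC.sqrt S) (ξ i)‖) ^ 2 := by ring
    _ ≤ 4 * (n * (n * (1 + C * 2) * S.trace)) := by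
        gcongr
        refine h3.trans (mul_le_mul_of_nonneg_left (h2.trans ?_) hn'.le)
        gcongr
    _ = _ := by ring

theorem contraction_lt_one (hε : 0 < ε) (hε' : ε < (5 - √5) / 10) : contraction ε < 1 := by
  have h5 : 11 / 5 < √5 := by rw [Real.lt_sqrt (by norm_num)]; norm_num
  have h2ε : 0 < 1 - 2 * ε := by linarith
  rw [contraction, div_lt_one h2ε, Real.sqrt_lt' h2ε]
  -- `(5 - √5) / 10` is the smaller root of `5 ε ^ 2 - 5 ε + 1`
  nlinarith [Real.sq_sqrt (by norm_num : (0 : ℝ) ≤ 5),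
    mul_pos (sub_pos.2 hε') (by linarith : 0 < (5 + √5) / 10 - ε)]

/-- The number of iterations is chosen so that the error of the initial estimator is reduced to
a level at which the effective rank no longer matters. -/
theorem contraction_pow_numIter_sq_mul_le (hε : 0 < ε) (hε' : ε ≤ 7 / 25)
    (hα : contraction ε < 1) (hr : 0 < effectiveRank S) :
    (contraction ε ^ numIter S ε) ^ 2 * (4 * effectiveRank S) ≤ (ε * (1 - 2 * ε)) ^ 2 := by
  have h1ε : 0 < 1 - ε := by linarith
  have h2ε : 0 < 1 - 2 * ε := by linarith
  have hα0 : 0 < contraction ε := by unfold contraction; positivity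
  have hlogα : 2 * Real.log (1 - 2 * ε) - Real.log ε - Real.log (1 - ε) =
      -2 * Real.log (contraction ε) := by
    rw [contraction, Real.log_div (by positivity) h2ε.ne', Real.log_sqrt (by positivity),
      Real.log_mul hε.ne' h1ε.ne']
    ring
  have hneg := Real.log_neg hα0 hα
  have hK := Nat.le_ceil ((Real.log (4 * effectiveRank S) - 2 * Real.log (ε * (1 - 2 * ε))) /
    (2 * Real.log (1 - 2 * ε) - Real.log ε - Real.log (1 - ε)))
  change _ ≤ (numIter S ε : ℝ) at hK
  rw [hlogα, div_le_iff₀ (by linarith)] at hK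
  rw [← Real.log_le_log_iff (by positivity) (by positivity),
    Real.log_mul (by positivity) (by positivity), Real.log_pow, Real.log_pow, Real.log_pow]
  push_cast
  linarith

/-- The error bound for a regular sample. -/
theorem IsIRMean.norm_sub_le {m : Vec p} (hm : IsIRMean S ε X m) (hS : S.PosSemidef)
    (hS0 : S ≠ 0) (hR : IsRegularSample C ε κ ξ) (hn : 0 < n)
    (hC : 0 ≤ C) (hε : 0 < ε) (hε' : ε < (5 - √5) / 10) (hκ : 0 ≤ κ)
    (hκ2 : κ ≤ 2) (hX : ∀ i ∈ I, X i = μ + toCLM (CFC.sqrt S) (ξ i))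
    (hI : (n : ℝ) - n * ε ≤ I.card) :
    ‖m - μ‖ ≤ (1 + 2 * C + 3 * (53 * C + 8)) * √(opNorm S) /
      (1 - 2 * ε - √(ε * (1 - ε))) * rate ε κ := by
  have hα := contraction_lt_one hε hε'
  have h5 : 11 / 5 < √5 := by rw [Real.lt_sqrt (by norm_num)]; norm_num
  have hε7 : ε ≤ 7 / 25 := by linarith
  have h1ε : 0 < 1 - ε := by linarith
  have h2ε : 0 < 1 - 2 * ε := by linarith
  have hα0 : 0 < contraction ε := by unfold contraction; positivity
  have hE := rate_nonneg (κ := κ) hε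
  have hop := opNorm_pos hS0
  have htr := trace_pos hS hS0
  have hr : 0 < effectiveRank S := div_pos htr hop
  obtain ⟨mu, w, hmed, hstep, rfl⟩ := hm
  set D := 3 * (53 * C + 8) * √(opNorm S) * rate ε κ with hD
  have hD0 : 0 ≤ D := by positivity
  have hiter : ∀ k ≤ numIter S ε,
      ‖mu k - μ‖ ≤ contraction ε ^ k * ‖mu 0 - μ‖ + D / (1 - contraction ε) := by
    intro k
    induction k with
    | zero =>
      intro _
      have : 0 ≤ D / (1 - contraction ε) := div_nonneg hD0 (by linarith)
      simpa using this
    | succ k ih =>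
      intro hk
      obtain ⟨hw, hmin, hmu⟩ := hstep k hk
      have h1 := norm_wmean_sub_le hS hR hn hC hε hε7 hα.le hκ hκ2 hX hI hw hmin
      rw [← hmu, ← hD] at h1
      have h2 := mul_le_mul_of_nonneg_left (ih (Nat.le_of_succ_le hk)) hα0.le
      have h3 : contraction ε * (D / (1 - contraction ε)) + D = D / (1 - contraction ε) := by
        have : 1 - contraction ε ≠ 0 := by linarith
        field_simp; ring
      rw [pow_succ]
      linarith
  have hinit : contraction ε ^ numIter S ε * ‖mu 0 - μ‖ ≤
      (1 + 2 * C) * √(opNorm S) * rate ε κ := by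
    have h1 := hmed.norm_sub_sq_le hS hR hn hC hε7 hκ2 hX hI
    have h2 := contraction_pow_numIter_sq_mul_le hε hε7 hα hr
    have h3 : contraction ε ^ numIter S ε * ‖mu 0 - μ‖ ≤ (1 + 2 * C) * √(opNorm S) * ε := by
      refine (abs_le_of_sq_le_sq' ?_ (by positivity)).2
      refine le_of_mul_le_mul_right ?_
        (by positivity : 0 < 4 * effectiveRank S * (1 - 2 * ε) ^ 2)
      have htr' : S.trace = effectiveRank S * opNorm S := by
        rw [effectiveRank, div_mul_cancel₀ _ hop.ne']
      calc (contraction ε ^ numIter S ε * ‖mu 0 - μ‖) ^ 2 *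
            (4 * effectiveRank S * (1 - 2 * ε) ^ 2)
          = ((contraction ε ^ numIter S ε) ^ 2 * (4 * effectiveRank S)) *
              ((1 - 2 * ε) * ‖mu 0 - μ‖) ^ 2 := by ring
        _ ≤ (ε * (1 - 2 * ε)) ^ 2 * (4 * (1 + 2 * C) * S.trace) := by gcongr
        _ = (1 + 2 * C) * (opNorm S * ε ^ 2 * (4 * effectiveRank S * (1 - 2 * ε) ^ 2)) := by
            rw [htr']; ring
        _ ≤ (1 + 2 * C) ^ 2 * (opNorm S * ε ^ 2 * (4 * effectiveRank S * (1 - 2 * ε) ^ 2)) := by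
            gcongr; nlinarith
        _ = _ := by rw [mul_pow, mul_pow, Real.sq_sqrt hop.le]; ring
    refine h3.trans ?_
    gcongr
    exact le_rate hε hε7
  have hden : 1 - 2 * ε - √(ε * (1 - ε)) = (1 - 2 * ε) * (1 - contraction ε) := by
    rw [contraction]; field_simp
  have hdpos : 0 < 1 - 2 * ε - √(ε * (1 - ε)) := by
    rw [hden]; exact mul_pos h2ε (by linarith)
  have h1 : D / (1 - contraction ε) ≤ D / (1 - 2 * ε - √(ε * (1 - ε))) := by
    refine div_le_div_of_nonneg_left hD0 hdpos ?_
    rw [hden]; nlinarith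
  have h2 : (1 + 2 * C) * √(opNorm S) * rate ε κ ≤
      (1 + 2 * C) * √(opNorm S) * rate ε κ / (1 - 2 * ε - √(ε * (1 - ε))) := by
    rw [le_div_iff₀ hdpos]
    refine mul_le_of_le_one_right (by positivity) ?_
    have := Real.sqrt_nonneg (ε * (1 - ε))
    linarith
  calc _ ≤ _ := hiter _ le_rfl
    _ ≤ (1 + 2 * C) * √(opNorm S) * rate ε κ / (1 - 2 * ε - √(ε * (1 - ε))) +
          D / (1 - 2 * ε - √(ε * (1 - ε))) := by linarith
    _ = _ := by rw [hD]; ring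

end Deterministic

/-- The failure probability over a half-net, at the deviation level
`κ = (p + log (4 / δ)) / n`: the factor `exp (-2 p)` absorbs the size of the net. -/
theorem five_pow_mul_exp_le {n p : ℕ} (hn : 0 < n) {δ : ℝ} (hδ : 0 < δ) (hδ1 : δ < 1) :
    5 ^ p * (5 * Real.exp (-(2 * n * ((p + Real.log (4 / δ)) / n)))) ≤ 4 * δ := by
  have hn' : (n : ℝ) ≠ 0 := by positivity
  have e : -(2 * n * ((p + Real.log (4 / δ)) / n)) = (p : ℝ) * (-2) + 2 * Real.log (δ / 4) := by
    rw [← inv_div δ 4, Real.log_inv]; field_simp; ring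
  have h2 : Real.exp (2 * Real.log (δ / 4)) = (δ / 4) ^ 2 := by
    rw [two_mul, Real.exp_add, Real.exp_log (by positivity), sq]
  have h5 : 5 * Real.exp (-2) ≤ 1 := by
    have h1 : 5 ≤ Real.exp 2 := by
      have := Real.quadratic_le_exp_of_nonneg (x := 2) (by norm_num)
      norm_num at this
      exact this
    rw [Real.exp_neg, ← div_eq_mul_inv, div_le_one (Real.exp_pos _)]
    exact h1
  rw [e, Real.exp_add, h2, Real.exp_nat_mul]
  calc 5 ^ p * (5 * (Real.exp (-2) ^ p * (δ / 4) ^ 2))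
      = (5 * Real.exp (-2)) ^ p * (5 / 16 * δ ^ 2) := by rw [mul_pow]; ring
    _ ≤ 1 * (5 / 16 * δ ^ 2) := by
        gcongr
        exact pow_le_one₀ (by positivity) h5
    _ ≤ _ := by nlinarith

end IRMean

theorem theorem2 (τ : ℝ) (hτ : 0 < τ) :
    ∃ A : ℝ, 0 < A ∧
      ∀ (n p : ℕ), 2 ≤ p → p ≤ n →
      ∀ ε : ℝ, 0 < ε → ε < (5 - Real.sqrt 5) / 10 →
      ∀ δ : ℝ, 4 * Real.exp (-(n : ℝ)) < δ → δ < 1 →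
      ∀ S : Matrix (Fin p) (Fin p) ℝ, S.PosSemidef → S ≠ 0 →
      ∀ μ : IRMean.Vec p,
      ∀ (Ω : Type*) [MeasurableSpace Ω] (P : Measure Ω) [IsProbabilityMeasure P]
        (X : Fin n → Ω → IRMean.Vec p), IRMean.SGAC P τ μ S ε X →
      ∀ muhat : Ω → IRMean.Vec p,
        (∀ ω, IRMean.IsIRMean S ε (fun i => X i ω) (muhat ω)) →
        P {ω | ¬ ‖muhat ω - μ‖ ≤
            A * Real.sqrt (IRMean.opNorm S) /
                (1 - 2 * ε - Real.sqrt (ε * (1 - ε))) *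
              (Real.sqrt ((p + Real.log (4 / δ)) / n) +
                ε * Real.sqrt (Real.log (1 / ε)))}
          ≤ ENNReal.ofReal (4 * δ) := by
  classical
  have hC : 0 < IRMean.regConst τ := by unfold IRMean.regConst; positivity
  refine ⟨1 + 2 * IRMean.regConst τ + 3 * (53 * IRMean.regConst τ + 8), by positivity, ?_⟩
  intro n p hp hpn ε hε hε' δ hδ hδ1 S hS hS0 μ Ω _ P _ X hX muhat hmu
  obtain ⟨-, ξ, hξ, hind, hout⟩ := hX
  have hn : 0 < n := by omega
  have hn' : (0 : ℝ) < n := by exact_mod_cast hn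
  have hδ0 : 0 < δ := lt_trans (by positivity) hδ
  have hlog0 : 0 ≤ Real.log (4 / δ) := Real.log_nonneg (by rw [le_div_iff₀ hδ0]; linarith)
  have hlogn : Real.log (4 / δ) ≤ n := by
    rw [Real.log_le_iff_le_exp (by positivity), div_le_iff₀ hδ0]
    rw [Real.exp_neg, ← div_eq_mul_inv, div_lt_iff₀ (Real.exp_pos _)] at hδ
    linarith
  have hκ : 0 ≤ (p + Real.log (4 / δ)) / n := by positivity
  have hκ2 : (p + Real.log (4 / δ)) / n ≤ 2 := by
    have : (p : ℝ) ≤ n := by exact_mod_cast hpn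
    rw [div_le_iff₀ hn']; linarith
  have hε1 : ε ≤ 1 := by linarith [Real.sqrt_nonneg 5]
  have hreg := IRMean.measure_not_isRegularSample_le (P := P) hn hτ hε hε1 hκ hκ2 hξ hind
  refine le_trans ?_ (hreg.trans (ENNReal.ofReal_le_ofReal
    (IRMean.five_pow_mul_exp_le hn hδ0 hδ1)))
  refine measure_mono_ae ?_
  filter_upwards [hout] with ω hω hbad hR
  refine hbad ((hmu ω).norm_sub_le hS hS0 hR hn hC.le hε hε' hκ hκ2
    (I := Finset.univ.filter fun i =>
      X i ω = μ + IRMean.toCLM (CFC.sqrt S) (ξ i ω)) (fun i hi => (Finset.mem_filter.1 hi).2) ?_)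
  have h1 := Finset.card_filter_add_card_filter_not (s := (Finset.univ : Finset (Fin n)))
    (fun i => X i ω = μ + IRMean.toCLM (CFC.sqrt S) (ξ i ω))
  rw [Finset.card_univ, Fintype.card_fin] at h1
  have h2 : {i : Fin n | X i ω ≠ μ + IRMean.toCLM (CFC.sqrt S) (ξ i ω)}.ncard =
      (Finset.univ.filter fun i =>
        ¬ X i ω = μ + IRMean.toCLM (CFC.sqrt S) (ξ i ω)).card := by
    rw [← Set.ncard_coe_finset]; simp
  rw [h2] at hω
  have h3 := congrArg (Nat.cast (R := ℝ)) h1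
  push_cast at h3
  linarith
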